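/- \textbf{Theorem B (Duality).} Let $\mathbb{F}=\mathbb{Q}(q,t)$ and $\mathbb{K}=\mathbb{Q}(q,t,a)$, let $n$ be a positive integer, $x=(x_1,\dots,x_n)$, and let $\mathcal{C}_n=(\mathbb{Z}_{\ge 0})^n$ be the set of compositions. For $v\in\mathbb{Z}^n$ put $|v|=v_1+\cdots+v_n$ and let $\overline{v}\in\mathbb{F}^n$ be the vector with entries $$\overline{v}_i=q^{v_i}t^{-k_i(v)},\qquad k_i(v)=\#\{k<i\mid v_k\ge v_i\}+\#\{k>i\mid v_k>v_i\}.$$ Put $\widetilde{v}=\overline{(-v_n,\dots,-v_1)}$ and $\tau=\overline{0}=(1,t^{-1},\dots,t^{1-n})$. Write $(y;q)_m=\prod_{j=0}^{m-1}(1-q^jy)$ and $(m^n)=(m,\dots,m)$. (1) For each $\alpha\in\mathcal{C}_n$ there is exactly one polynomial $G_\alpha\in\mathbb{F}[x]$ of total degree at most $|\alpha|$ such that $G_\alpha(\overline{\beta})=0$ for all $\beta\in\mathcal{C}_n$ with $|\beta|\le|\alpha|$ and $\beta\ne\alpha$, and such that the coefficient of $x^\alpha$ in $G_\alpha$ is $1$.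 Put $K_\alpha(x)=G_\alpha(x)/G_\alpha(a\tau)\in\mathbb{K}[x]$. (2) For each $v\in\mathbb{Z}^n$ the rational functions $G_v\in\mathbb{F}(x)$ and $K_v\in\mathbb{K}(x)$ given by $$G_v(x)=q^{-m|v|-m^2n}\,\frac{G_{v+(m^n)}(q^mx)}{\prod_{i=1}^n x_i^m\,\bigl(q^{-m}t^{1-n}x_i^{-1};q\bigr)_m},\qquad K_v(x)=\Bigl(\prod_{i=1}^n\frac{\bigl(q^{1-m}a\overline{v}_i^{-1};q\bigr)_m}{\bigl(qt^{n-1}x_i;q\bigr)_m}\Bigr)K_{v+(m^n)}(q^mx)$$ do not depend on the choice of the integer $m\ge 0$ with $v+(m^n)\in\mathcal{C}_n$. (3) For each $v\in\mathbb{Z}^n$, $G_v$ is regular at $a\tau$, $G_v(a\tau)\neq 0$, and $K_v(x)=G_v(x)/G_v(a\tau)$. (4) (Duality) For all $u,v\in\mathbb{Z}^n$, $K_u$ is regular at $a\widetilde{v}$, $K_v$ is regular at $a\widetilde{u}$, and $$K_u(a\widetilde{v})=K_v(a\widetilde{u}).$$ This is the non-symmetric analogue of Okounkov's evaluation symmetry.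 -/

import Mathlib

noncomputable section

namespace InterpMac

open MvPolynomial

/-! ### The base fields -/

/-- The field `𝔽 = ℚ(q, t)`. -/
abbrev BaseF : Type := FractionRing (MvPolynomial (Fin 2) ℚ)

/-- The indeterminate `q` in `𝔽`. -/
def qF : BaseF := algebraMap (MvPolynomial (Fin 2) ℚ) BaseF (X 0)

/-- The indeterminate `t` in `𝔽`. -/
def tF : BaseF := algebraMap (MvPolynomial (Fin 2) ℚ) BaseF (X 1)

/-- The field `𝕂 = 𝔽(a) = ℚ(q, t, a)`. -/
abbrev BaseK : Type := RatFunc BaseF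

/-- The inclusion of `𝔽` into `𝕂`. -/
def inclFK : BaseF →+* BaseK := RatFunc.C

/-- `q` as an element of `𝕂`. -/
def qK : BaseK := inclFK qF

/-- `t` as an element of `𝕂`. -/
def tK : BaseK := inclFK tF

/-- The indeterminate `a` in `𝕂`. -/
def aK : BaseK := RatFunc.X

/-! ### Spectral vectors -/

/-- `k_i(v) = #{k < i | v_k ≥ v_i} + #{k > i | v_k > v_i}`. -/
def kIndex {n : ℕ} (v : Fin n → ℤ) (i : Fin n) : ℕ :=
  (Finset.univ.filter fun k : Fin n => k < i ∧ v i ≤ v k).card +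
    (Finset.univ.filter fun k : Fin n => i < k ∧ v i < v k).card

/-- The spectral vector `v̄`, with entries `q ^ v_i * t ^ (-k_i(v))`. -/
def bar {k : Type*} [Field k] (q t : k) {n : ℕ} (v : Fin n → ℤ) : Fin n → k :=
  fun i => q ^ (v i) * t ^ (-(kIndex v i : ℤ))

/-- The vector `ṽ`, which is the spectral vector of `-w₀ v = (-v_n, …, -v_1)`. -/
def tilde {k : Type*} [Field k] (q t : k) {n : ℕ} (v : Fin n → ℤ) : Fin n → k :=
  bar q t fun i => -v i.rev

/-- `τ = (1, t⁻¹, …, t ^ (1 - n))`; the index `i` runs from `0` to `n - 1`. -/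
def tau {k : Type*} [Field k] (t : k) (n : ℕ) : Fin n → k :=
  fun i => t ^ (-((i : ℕ) : ℤ))

/-! ### Interpolation polynomials for compositions -/

/-- The defining properties of the non-symmetric interpolation Macdonald polynomial of the
composition `α`: degree at most `|α|`, vanishing at `β̄` for all compositions `β ≠ α` with
`|β| ≤ |α|`, and coefficient `1` at `x ^ α`. -/
def IsInterp {k : Type*} [Field k] (q t : k) {n : ℕ} (α : Fin n → ℕ)
    (P : MvPolynomial (Fin n) k) : Prop :=
  P.totalDegree ≤ ∑ i, α i ∧
    (∀ β : Fin n → ℕ, ∑ i, β i ≤ ∑ i, α i → β ≠ α →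
      eval (bar q t fun i => (β i : ℤ)) P = 0) ∧
    coeff (Finsupp.equivFunOnFinite.symm α) P = 1

open Classical in
/-- `G_α(x; q, t) ∈ 𝔽[x]` for a composition `α`: the polynomial with the defining properties
(default value `0` if there were none). -/
def polyG {n : ℕ} (α : Fin n → ℕ) : MvPolynomial (Fin n) BaseF :=
  if h : ∃ P, IsInterp qF tF α P then h.choose else 0

/-- `K_α(x; q, t; a) = G_α(x) / G_α(a τ) ∈ 𝕂[x]` for a composition `α`. -/
def polyK {n : ℕ} (α : Fin n → ℕ) : MvPolynomial (Fin n) BaseK :=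
  C (eval (fun i => aK * tau tK n i) (map inclFK (polyG α)))⁻¹ * map inclFK (polyG α)

/-! ### Rational functions and their values -/

/-- The field `k(x) = k(x_1, …, x_n)` of rational functions. -/
abbrev RatFun (n : ℕ) (k : Type*) [Field k] : Type _ := FractionRing (MvPolynomial (Fin n) k)

/-- A polynomial as a rational function. -/
def ofPoly {n : ℕ} {k : Type*} [Field k] : MvPolynomial (Fin n) k →+* RatFun n k :=
  algebraMap (MvPolynomial (Fin n) k) (RatFun n k)

/-- The inclusion of `𝔽(x)` into `𝕂(x)`. -/
def inclRat (n : ℕ) : RatFun n BaseF →+* RatFun n BaseK :=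
  IsFractionRing.lift (A := MvPolynomial (Fin n) BaseF)
    (g := (ofPoly (n := n) (k := BaseK)).comp (map inclFK))
    ((IsFractionRing.injective (MvPolynomial (Fin n) BaseK) (RatFun n BaseK)).comp
      (map_injective inclFK inclFK.injective))

/-- The rational function `f` is regular at the point `y` and has the value `c` there: `f` can be
written as a quotient `p / d` of polynomials with `d(y) ≠ 0` and `p(y) / d(y) = c`. -/
def HasValueAt {n : ℕ} {k : Type*} [Field k] (f : RatFun n k) (y : Fin n → k) (c : k) : Prop :=
  ∃ p d : MvPolynomial (Fin n) k, eval y d ≠ 0 ∧ f = ofPoly p / ofPoly d ∧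
    c = eval y p / eval y d

/-- The value of a rational function at a point is unique. -/
theorem HasValueAt.unique {n : ℕ} {k : Type*} [Field k] {f : RatFun n k} {y : Fin n → k}
    {c c' : k} (h : HasValueAt f y c) (h' : HasValueAt f y c') : c = c' := by
  obtain ⟨p, d, hd, hf, rfl⟩ := h
  obtain ⟨p', d', hd', hf', rfl⟩ := h'
  have inj : Function.Injective (ofPoly (n := n) (k := k)) :=
    IsFractionRing.injective (MvPolynomial (Fin n) k) (RatFun n k)
  have ne : ∀ e : MvPolynomial (Fin n) k, eval y e ≠ 0 → ofPoly e ≠ 0 := by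
    intro e he h0
    apply he
    rw [(map_eq_zero_iff ofPoly inj).mp h0, map_zero]
  rw [hf, div_eq_div_iff (ne d hd) (ne d' hd'), ← map_mul, ← map_mul] at hf'
  rw [div_eq_div_iff hd hd', ← map_mul, ← map_mul, inj hf']

/-! ### Extension to integral vectors -/

/-- The polynomial `P(c x)`. -/
def dilate {n : ℕ} {k : Type*} [Field k] (c : k) (P : MvPolynomial (Fin n) k) :
    MvPolynomial (Fin n) k :=
  bind₁ (fun i => C c * X i) P

/-- The `q`-shifted factorial `(y; q)_m = ∏_{j < m} (1 - q ^ j y)`. -/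
def qPoch {k : Type*} [Field k] (q y : k) (m : ℕ) : k :=
  ∏ j ∈ Finset.range m, (1 - q ^ j * y)

/-- `v + (m ^ n)`, as a composition (used only if all entries of `v + (m ^ n)` are nonnegative). -/
def shiftComp {n : ℕ} (m : ℕ) (v : Fin n → ℤ) : Fin n → ℕ :=
  fun i => (v i + m).toNat

/-- The rational function
`q ^ (-m|v| - m² n) * G_{v + (m ^ n)}(q ^ m x) / ∏_i x_i ^ m (q ^ (-m) t ^ (1 - n) x_i⁻¹; q)_m`. -/
def shiftG {n : ℕ} (m : ℕ) (v : Fin n → ℤ) : RatFun n BaseF :=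
  ofPoly (C (qF ^ (-(m : ℤ) * (∑ i, v i) - (m : ℤ) ^ 2 * n)) *
      dilate (qF ^ m) (polyG (shiftComp m v))) /
    ∏ i, (ofPoly (X i) ^ m *
      qPoch (ofPoly (C qF)) (ofPoly (C (qF ^ (-(m : ℤ)) * tF ^ (1 - (n : ℤ)))) * (ofPoly (X i))⁻¹) m)

/-- `A_m(x; v) = ∏_i (q ^ (1 - m) a v̄_i⁻¹; q)_m / (q t ^ (n - 1) x_i; q)_m`. -/
def ratA {n : ℕ} (m : ℕ) (v : Fin n → ℤ) : RatFun n BaseK :=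
  ∏ i, (ofPoly (C (qPoch qK (qK ^ (1 - (m : ℤ)) * aK * (bar qK tK v i)⁻¹) m)) /
    qPoch (ofPoly (C qK)) (ofPoly (C (qK * tK ^ ((n : ℤ) - 1)) * X i)) m)

/-- The rational function `A_m(x; v) K_{v + (m ^ n)}(q ^ m x)`. -/
def shiftK {n : ℕ} (m : ℕ) (v : Fin n → ℤ) : RatFun n BaseK :=
  ratA m v * ofPoly (dilate (qK ^ m) (polyK (shiftComp m v)))

/-- The least `m ≥ 0` such that `v + (m ^ n)` is a composition. -/
def minShift {n : ℕ} (v : Fin n → ℤ) : ℕ :=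
  Finset.univ.sup fun i => (-v i).toNat

/-- `G_v ∈ 𝔽(x)` for an integral vector `v`. -/
def ratG {n : ℕ} (v : Fin n → ℤ) : RatFun n BaseF := shiftG (minShift v) v

/-- `K_v ∈ 𝕂(x)` for an integral vector `v`. -/
def ratK {n : ℕ} (v : Fin n → ℤ) : RatFun n BaseK := shiftK (minShift v) v

end InterpMac

end

noncomputable section

namespace InterpMac

open MvPolynomial

/-! ### Combinatorics of spectral vectors -/

section Bar

/-! Write F(v, u) for the value of K_v at aũ. The duality F(v, u) = F(u, v) holds because F(v, 0) =
F(0, u) = 1 and because the recurrences that compute F from these values are carried into themselves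
when v and u are exchanged.

Everything rests on one uniqueness principle, `eq_zero_of_vanishing`: a polynomial of degree at most
d is determined by its values at the spectral vectors of the compositions of size at most d. Hence a
polynomial with the degree bound and the zeros of G_v is a multiple of G_v. Existence
(`exists_isInterp`) is the nonvanishing of a determinant, tested at q = 2, t = 1, where the
interpolation polynomials are explicit products.

Compositions arise from 0 by adjacent transpositions and the cyclic raising map `rot`
(`comp_induction`). By uniqueness, `hecke` sends G_v to a combination of G_v and its transposed
partner (`IsFamily.exists_hecke_eq`), and `raise` sends it to a multiple of the polynomial of `rot
v` (`IsFamily.exists_raise_eq`). The unknown constants cancel on division by the value at aτ, once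
both operators can be evaluated there. For `hecke` this is immediate, since it multiplies values at
multiples of τ by t. For `raise` the point leaves the line through τ, and the eigenvalue equation of
the inhomogeneous Cherednik operator brings it back (`IsFamily.eval_unrot_tau`). That equation also
yields the product formula `normEval_mul_tau`, which gives F(v, 0) = 1 and the constants in shifts
by (1^n).

Up to a power of t, ũ is the reversed inverse of ū. Transposing unequal adjacent entries of u
therefore transposes coordinates of ũ, and the cyclic map on points raises u (`unrot_tilde`). This
makes `extEval_hecke` and `extEval_rot` symmetric in v and u up to exchanging sides. Induction over
compositions v, with u arbitrary, proves the symmetry, and `extEval_succ_eq`, which trades (v, u)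
for (v + 1, u - 1), extends it to integral v (`symm_of_recurrences`).

Finally, G_v and K_v have proportional numerators and proportional denominators, and K_v(aτ) = 1
identifies the factor between them as G_v(aτ). -/

theorem kIndex_eq_card {n : ℕ} (v : Fin n → ℤ) (i : Fin n) :
    kIndex v i = (Finset.univ.filter fun k : Fin n =>
      (k < i ∧ v i ≤ v k) ∨ (i < k ∧ v i < v k)).card := by
  rw [kIndex, Finset.filter_or, Finset.card_union_of_disjoint]
  rw [Finset.disjoint_filter]
  rintro k - ⟨h, -⟩ ⟨h', -⟩
  exact lt_asymm h h'

theorem kIndex_eq_sum {n : ℕ} (v : Fin n → ℤ) (i : Fin n) :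
    kIndex v i = ∑ k : Fin n, if (k < i ∧ v i ≤ v k) ∨ (i < k ∧ v i < v k) then 1 else 0 := by
  rw [kIndex_eq_card, Finset.card_filter]

theorem swap_lt_swap_iff {n : ℕ} {i j : Fin n} (hij : (j : ℕ) = i + 1) {k l : Fin n}
    (h : ¬ (k = i ∧ l = j)) (h' : ¬ (k = j ∧ l = i)) :
    Equiv.swap i j k < Equiv.swap i j l ↔ k < l := by
  simp only [Equiv.swap_apply_def, Fin.lt_def, Fin.ext_iff] at *
  split_ifs <;> omega

/-- The transposition changes the relative order of no pair of positions except (i, j), and for that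
pair ≤ and < agree because the entries differ. -/
theorem kIndex_comp_swap {n : ℕ} {i j : Fin n} (hij : (j : ℕ) = i + 1) {v : Fin n → ℤ}
    (hv : v i ≠ v j) (l : Fin n) :
    kIndex (v ∘ Equiv.swap i j) l = kIndex v (Equiv.swap i j l) := by
  rw [kIndex_eq_sum, kIndex_eq_sum, ← Equiv.sum_comp (Equiv.swap i j)]
  refine Finset.sum_congr rfl fun k _ => if_congr ?_ rfl rfl
  simp only [Function.comp_apply, Equiv.swap_apply_self]
  set s := Equiv.swap i j with hs
  have e1 : s (s l) = l := Equiv.swap_apply_self i j l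
  by_cases h1 : k = i ∧ s l = j
  · have h2 : l = i := by rw [← e1, h1.2, hs, Equiv.swap_apply_right]
    have h3 : s k = j := by rw [h1.1, hs, Equiv.swap_apply_left]
    simp only [h1, h2, Fin.lt_def, hij] at *
    grind
  by_cases h2 : k = j ∧ s l = i
  · have h3 : l = j := by rw [← e1, h2.2, hs, Equiv.swap_apply_left]
    have h4 : s k = i := by rw [h2.1, hs, Equiv.swap_apply_right]
    simp only [h2, h3, Fin.lt_def, hij] at *
    grind
  have h3 := swap_lt_swap_iff hij h1 h2
  have h4 : s (s l) < s k ↔ s l < k := swap_lt_swap_iff hij (by tauto) (by tauto)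
  rw [← hs] at h3
  rw [e1] at h3 h4
  rw [h3, h4]

/-- Position j counts everything that i counts, and in addition i itself, as an earlier equal entry.
-/
theorem kIndex_of_eq {n : ℕ} {i j : Fin n} (hij : (j : ℕ) = i + 1) {v : Fin n → ℤ}
    (hv : v i = v j) : kIndex v j = kIndex v i + 1 := by
  rw [kIndex_eq_card, kIndex_eq_card, ← Finset.card_insert_of_notMem (a := i)]
  · congr 1
    ext k
    simp only [Finset.mem_filter, Finset.mem_insert, Finset.mem_univ, true_and, Fin.lt_def,
      Fin.ext_iff, hv]
    constructor
    · rintro (h | h)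
      · by_cases hk : (k : ℕ) = i
        · exact Or.inl hk
        · exact Or.inr (Or.inl ⟨by omega, h.2⟩)
      · exact Or.inr (Or.inr ⟨by omega, h.2⟩)
    · rintro (h | h | h)
      · left
        have : k = i := Fin.ext h
        exact ⟨by omega, by rw [this, hv]⟩
      · exact Or.inl ⟨by omega, h.2⟩
      · right
        refine ⟨?_, h.2⟩
        by_contra hk
        have : k = j := Fin.ext (by omega)
        rw [this] at h
        exact lt_irrefl _ h.2
  · simp

theorem kIndex_add_const {n : ℕ} (v : Fin n → ℤ) (c : ℤ) (i : Fin n) :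
    kIndex (fun l => v l + c) i = kIndex v i := by
  simp only [kIndex_eq_sum, add_le_add_iff_right, add_lt_add_iff_right]

theorem kIndex_zero {n : ℕ} (i : Fin n) : kIndex (0 : Fin n → ℤ) i = i := by
  rw [kIndex_eq_card]
  simp [Finset.filter_gt_eq_Iio]

/-- Reversing positions and negating values complements the counting condition, so each position
other than `i.rev` is counted by exactly one of the two terms. -/
theorem kIndex_add_kIndex_neg_rev {n : ℕ} (v : Fin n → ℤ) (i : Fin n) :
    kIndex (fun l => -v l.rev) i + kIndex v i.rev + 1 = n := by
  rw [kIndex_eq_sum, kIndex_eq_sum, ← Equiv.sum_comp Fin.revPerm, ← Finset.sum_add_distrib]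
  have : ∀ k : Fin n, ((if (Fin.revPerm k < i ∧ -v i.rev ≤ -v (Fin.revPerm k).rev) ∨
      (i < Fin.revPerm k ∧ -v i.rev < -v (Fin.revPerm k).rev) then 1 else 0) +
      if (k < i.rev ∧ v i.rev ≤ v k) ∨ (i.rev < k ∧ v i.rev < v k) then 1 else 0) =
      if k = i.rev then 0 else 1 := by
    intro k
    have e1 : k.rev < i ↔ i.rev < k := Fin.rev_lt_iff
    have e2 : i < k.rev ↔ k < i.rev := Fin.lt_rev_iff
    simp only [Fin.revPerm_apply, Fin.rev_rev, neg_le_neg_iff, neg_lt_neg_iff, e1, e2]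
    rcases lt_trichotomy k i.rev with h | h | h
    · simp only [h, h.ne, h.not_gt]
      grind
    · simp [h]
    · simp only [h, h.ne', h.not_gt]
      grind
  rw [Finset.sum_congr rfl fun k _ => this k]
  have h2 : ∑ k : Fin n, (if k = i.rev then 0 else 1) + ∑ k : Fin n, (if k = i.rev then 1 else 0)
      = n := by
    rw [← Finset.sum_add_distrib]
    rw [Finset.sum_congr rfl (g := fun _ => 1) (fun k _ => by split_ifs <;> rfl)]
    simp
  simpa using h2

/-- The cyclic raising map `(v_1, …, v_n) ↦ (v_2, …, v_n, v_1 + 1)`. -/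
def rot {n : ℕ} (v : Fin (n + 1) → ℤ) : Fin (n + 1) → ℤ :=
  Fin.snoc (α := fun _ => ℤ) (fun i : Fin n => v i.succ) (v 0 + 1)

@[simp] theorem rot_castSucc {n : ℕ} (v : Fin (n + 1) → ℤ) (i : Fin n) :
    rot v i.castSucc = v i.succ := by
  simp [rot]

@[simp] theorem rot_last {n : ℕ} (v : Fin (n + 1) → ℤ) : rot v (Fin.last n) = v 0 + 1 := by
  simp [rot]

/-- The moved entry passes from before to after position i, and v_1 ≥ v_i is equivalent to v_1 + 1 >
v_i. -/
theorem kIndex_rot_castSucc {n : ℕ} (v : Fin (n + 1) → ℤ) (i : Fin n) :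
    kIndex (rot v) i.castSucc = kIndex v i.succ := by
  rw [kIndex_eq_sum, kIndex_eq_sum, Fin.sum_univ_castSucc, Fin.sum_univ_succ, add_comm]
  congr 1
  · have : ¬ Fin.last n < i.castSucc := (Fin.castSucc_lt_last i).not_gt
    simp [Fin.castSucc_lt_last, this]
  · simp

theorem kIndex_rot_last {n : ℕ} (v : Fin (n + 1) → ℤ) :
    kIndex (rot v) (Fin.last n) = kIndex v 0 := by
  rw [kIndex_eq_sum, kIndex_eq_sum, Fin.sum_univ_castSucc, Fin.sum_univ_succ, add_comm]
  congr 1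
  · simp
  · refine Finset.sum_congr rfl fun i _ => ?_
    have : ¬ Fin.last n < i.castSucc := (Fin.castSucc_lt_last i).not_gt
    simp [Fin.castSucc_lt_last, this]

theorem kIndex_castSucc_of_last_eq_zero {n : ℕ} {v : Fin (n + 1) → ℤ} (hv : 0 ≤ v)
    (h : v (Fin.last n) = 0) (i : Fin n) :
    kIndex v i.castSucc = kIndex (fun l : Fin n => v l.castSucc) i := by
  rw [kIndex_eq_sum, kIndex_eq_sum, Fin.sum_univ_castSucc]
  have h1 : ¬ (v i.castSucc < 0) := not_lt.mpr (hv _)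
  have h2 : ¬ (Fin.last n < i.castSucc) := (Fin.castSucc_lt_last i).not_gt
  simp [h, h1, h2]

/-- The last zero entry works: all earlier entries are ≥ 0 and all later ones are > 0, so every
other position is counted. Its spectral coordinate is t^(1 - n), the root of the linear factors in
`raiseAll`. -/
theorem exists_kIndex_eq {n : ℕ} {v : Fin n → ℤ} (hv : 0 ≤ v) (h : ∃ i, v i = 0) :
    ∃ i, v i = 0 ∧ kIndex v i + 1 = n := by
  obtain ⟨i, hi, hmax⟩ := Finset.exists_max_image (Finset.univ.filter fun i : Fin n => v i = 0) id
    (by obtain ⟨i, hi⟩ := h; exact ⟨i, by simp [hi]⟩)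
  simp only [Finset.mem_filter, Finset.mem_univ, true_and, id] at hi hmax
  refine ⟨i, hi, ?_⟩
  have : (Finset.univ.filter fun k : Fin n => (k < i ∧ v i ≤ v k) ∨ (i < k ∧ v i < v k)) =
      Finset.univ.erase i := by
    ext k
    simp only [Finset.mem_filter, Finset.mem_univ, true_and, Finset.mem_erase, hi, and_true]
    have h0 : 0 ≤ v k := hv k
    constructor
    · rintro (⟨h, -⟩ | ⟨h, -⟩)
      · exact h.ne
      · exact h.ne'
    · intro hk
      rcases lt_or_gt_of_ne hk with h | h
      · exact Or.inl ⟨h, h0⟩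
      · refine Or.inr ⟨h, lt_of_le_of_ne h0 fun h1 => ?_⟩
        exact absurd (hmax k h1.symm) (not_le.mpr h)
  rw [kIndex_eq_card, this, Finset.card_erase_of_mem (Finset.mem_univ i), Finset.card_univ,
    Fintype.card_fin]
  have := i.pos
  omega

variable {k : Type*} [Field k] (q t : k)

theorem bar_comp_swap {n : ℕ} {i j : Fin n} (hij : (j : ℕ) = i + 1) {v : Fin n → ℤ}
    (hv : v i ≠ v j) : bar q t (v ∘ Equiv.swap i j) = bar q t v ∘ Equiv.swap i j := by
  funext l
  simp [bar, kIndex_comp_swap hij hv]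

variable {t} in
theorem bar_of_eq (ht : t ≠ 0) {n : ℕ} {i j : Fin n} (hij : (j : ℕ) = i + 1) {v : Fin n → ℤ}
    (hv : v i = v j) : bar q t v i = t * bar q t v j := by
  simp only [bar, kIndex_of_eq hij hv, hv]
  have : t ^ (-(kIndex v i : ℤ)) = t * t ^ (-((kIndex v i + 1 : ℕ) : ℤ)) := by
    rw [← zpow_one_add₀ ht]
    congr 1
    push_cast
    ring
  rw [this]
  ring

variable {q} in
theorem bar_add_const (hq : q ≠ 0) {n : ℕ} (v : Fin n → ℤ) (c : ℤ) :
    bar q t (fun l => v l + c) = fun i => q ^ c * bar q t v i := by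
  funext i
  simp only [bar, kIndex_add_const, zpow_add₀ hq]
  ring

theorem bar_zero {n : ℕ} : bar q t (0 : Fin n → ℤ) = tau t n := by
  funext i
  simp [bar, tau, kIndex_zero]

variable {q t} in
theorem bar_ne_zero (hq : q ≠ 0) (ht : t ≠ 0) {n : ℕ} (v : Fin n → ℤ) (i : Fin n) :
    bar q t v i ≠ 0 :=
  mul_ne_zero (zpow_ne_zero _ hq) (zpow_ne_zero _ ht)

variable {t} in
theorem tilde_eq (ht : t ≠ 0) {n : ℕ} (v : Fin n → ℤ) (i : Fin n) :
    tilde q t v i = t ^ (1 - (n : ℤ)) * (bar q t v i.rev)⁻¹ := by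
  have h := kIndex_add_kIndex_neg_rev v i
  simp only [tilde, bar, mul_inv, ← zpow_neg, neg_neg]
  rw [mul_left_comm, ← zpow_add₀ ht]
  congr 2
  omega

theorem tilde_zero {n : ℕ} : tilde q t (0 : Fin n → ℤ) = tau t n := by
  rw [← bar_zero q t, tilde]
  congr 1

variable {q} in
theorem bar_rot_castSucc {n : ℕ} (v : Fin (n + 1) → ℤ) (i : Fin n) :
    bar q t (rot v) i.castSucc = bar q t v i.succ := by
  simp [bar, kIndex_rot_castSucc]

variable {q} in
theorem bar_rot_last (hq : q ≠ 0) {n : ℕ} (v : Fin (n + 1) → ℤ) :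
    bar q t (rot v) (Fin.last n) = q * bar q t v 0 := by
  simp [bar, kIndex_rot_last, zpow_add₀ hq]
  ring

/-- The point `(x_n / q, x_1, …, x_{n-1})`. -/
def unrot {n : ℕ} (x : Fin (n + 1) → k) : Fin (n + 1) → k :=
  Fin.cons (α := fun _ => k) (q⁻¹ * x (Fin.last n)) fun i : Fin n => x i.castSucc

@[simp] theorem unrot_zero {n : ℕ} (x : Fin (n + 1) → k) : unrot q x 0 = q⁻¹ * x (Fin.last n) := by
  simp [unrot]

@[simp] theorem unrot_succ {n : ℕ} (x : Fin (n + 1) → k) (i : Fin n) :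
    unrot q x i.succ = x i.castSucc := by
  simp [unrot]

variable {q} in
theorem unrot_bar_rot (hq : q ≠ 0) {n : ℕ} (v : Fin (n + 1) → ℤ) :
    unrot q (bar q t (rot v)) = bar q t v := by
  funext i
  refine Fin.cases ?_ (fun i => ?_) i
  · simp [bar_rot_last t hq, hq]
  · simp [bar_rot_castSucc]

theorem unrot_smul {n : ℕ} (c : k) (x : Fin (n + 1) → k) :
    unrot q (fun i => c * x i) = fun i => c * unrot q x i := by
  funext i
  refine Fin.cases ?_ (fun i => ?_) i
  · simp
    ring
  · simp

/-- Conjugation by v ↦ -w₀v inverts `rot`; this is why `unrot`, which lowers spectral vectors,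
raises the index of `tilde`. -/
theorem rot_neg_rev_rot {n : ℕ} (v : Fin (n + 1) → ℤ) :
    rot (fun i => -rot v i.rev) = fun i => -v i.rev := by
  funext i
  refine Fin.lastCases ?_ (fun i => ?_) i
  · simp
  · rw [rot_castSucc, Fin.rev_succ, rot_castSucc, Fin.rev_castSucc]

variable {q} in
theorem unrot_tilde (hq : q ≠ 0) {n : ℕ} (v : Fin (n + 1) → ℤ) :
    unrot q (tilde q t v) = tilde q t (rot v) := by
  rw [tilde, ← rot_neg_rev_rot, unrot_bar_rot t hq, tilde]

variable {t} in
theorem tilde_comp_swap {n : ℕ} {i j : Fin n} (hij : (j : ℕ) = i + 1)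
    {v : Fin n → ℤ} (hv : v i ≠ v j) :
    tilde q t (v ∘ Equiv.swap i j) = tilde q t v ∘ Equiv.swap j.rev i.rev := by
  have hij' : ((i.rev : Fin n) : ℕ) = j.rev + 1 := by
    simp only [Fin.val_rev]
    omega
  rw [tilde, tilde, ← bar_comp_swap q t hij']
  · congr 1
    funext l
    simp only [Function.comp_apply, neg_inj]
    congr 1
    simp only [Equiv.swap_apply_def, Fin.ext_iff, Fin.val_rev]
    split_ifs <;> (try simp only [Fin.val_rev]) <;> omega
  · simpa using hv.symm

variable {q} in
theorem tilde_add_const (hq : q ≠ 0) {n : ℕ} (v : Fin n → ℤ) (c : ℤ) :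
    tilde q t (fun l => v l + c) = fun i => q ^ (-c) * tilde q t v i := by
  rw [tilde, tilde, ← bar_add_const t hq]
  congr 1
  funext i
  ring

end Bar

/-! ### Polynomials vanishing on spectral vectors -/

section Poly

variable {k : Type*} [Field k]

theorem totalDegree_bind₁_le {σ τ : Type*} {g : σ → MvPolynomial τ k}
    (hg : ∀ i, (g i).totalDegree ≤ 1) (f : MvPolynomial σ k) :
    (bind₁ g f).totalDegree ≤ f.totalDegree := by
  rw [bind₁, aeval_def, eval₂_eq]
  refine totalDegree_finsetSum_le fun d hd => ?_
  refine (totalDegree_mul _ _).trans ?_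
  rw [algebraMap_eq, totalDegree_C, zero_add]
  refine (totalDegree_finsetProd _ _).trans ?_
  refine le_trans (Finset.sum_le_sum fun i _ => ?_) (le_totalDegree hd)
  refine (totalDegree_pow _ _).trans ?_
  simpa using Nat.mul_le_mul_left (d i) (hg i)

theorem eval_bind₁ {σ τ : Type*} (g : σ → MvPolynomial τ k) (f : MvPolynomial σ k) (x : τ → k) :
    eval x (bind₁ g f) = eval (fun i => eval x (g i)) f := by
  exact eval₂Hom_bind₁ (RingHom.id k) x g f

/-- Modulo X_i - c every polynomial agrees with the result of substituting c for X_i, and here that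
result vanishes as a function on an infinite field. -/
theorem X_sub_C_dvd_of_eval [Infinite k] {σ : Type*} {f : MvPolynomial σ k} {i : σ} {c : k}
    (h : ∀ x : σ → k, x i = c → eval x f = 0) : X i - C c ∣ f := by
  classical
  have h0 : bind₁ (Function.update X i (C c)) f = 0 := by
    refine funext fun x => ?_
    rw [eval_bind₁, map_zero]
    refine h _ ?_
    simp
  have h1 : ∀ p : MvPolynomial σ k, X i - C c ∣ p - bind₁ (Function.update X i (C c)) p := by
    intro p
    induction p using MvPolynomial.induction_on with
    | C a => simp
    | add p q hp hq =>
      rw [map_add, add_sub_add_comm]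
      exact dvd_add hp hq
    | mul_X p l hp =>
      rw [map_mul, bind₁_X_right]
      have : p * X l - bind₁ (Function.update X i (C c)) p * Function.update X i (C c) l =
          (p - bind₁ (Function.update X i (C c)) p) * X l +
          bind₁ (Function.update X i (C c)) p * (X l - Function.update X i (C c) l) := by ring
      rw [this]
      refine dvd_add (hp.mul_right _) (Dvd.dvd.mul_left ?_ _)
      rcases eq_or_ne l i with rfl | hl
      · simp
      · simp [hl]
  simpa [h0] using h1 f

theorem totalDegree_X_sub_C {σ : Type*} (i : σ) (c : k) :
    (X i - C c : MvPolynomial σ k).totalDegree = 1 := by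
  rw [sub_eq_add_neg, ← map_neg, totalDegree_add_eq_left_of_totalDegree_lt] <;> simp

theorem X_sub_C_ne_zero {σ : Type*} (i : σ) (c : k) : (X i - C c : MvPolynomial σ k) ≠ 0 := by
  intro h
  have := totalDegree_X_sub_C i c
  simp [h] at this

theorem X_sub_X_ne_zero {σ : Type*} {i j : σ} (hij : i ≠ j) :
    (X i - X j : MvPolynomial σ k) ≠ 0 :=
  sub_ne_zero.mpr fun h => hij (X_injective h)

/-- The polynomial `f(x_n / q, x_1, …, x_{n-1})`. -/
def unrotPoly (q : k) {n : ℕ} (f : MvPolynomial (Fin (n + 1)) k) : MvPolynomial (Fin (n + 1)) k :=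
  bind₁ (Fin.cons (α := fun _ => MvPolynomial (Fin (n + 1)) k) (C q⁻¹ * X (Fin.last n))
    fun i : Fin n => X i.castSucc) f

theorem eval_unrotPoly (q : k) {n : ℕ} (f : MvPolynomial (Fin (n + 1)) k) (x : Fin (n + 1) → k) :
    eval x (unrotPoly q f) = eval (unrot q x) f := by
  rw [unrotPoly, eval_bind₁]
  congr 2
  funext i
  refine Fin.cases ?_ (fun i => ?_) i <;> simp

theorem totalDegree_unrotPoly_le (q : k) {n : ℕ} (f : MvPolynomial (Fin (n + 1)) k) :
    (unrotPoly q f).totalDegree ≤ f.totalDegree := by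
  refine totalDegree_bind₁_le (fun i => ?_) f
  refine Fin.cases ?_ (fun i => ?_) i
  · rw [Fin.cons_zero]
    refine (totalDegree_mul _ _).trans ?_
    rw [totalDegree_C, totalDegree_X]
  · rw [Fin.cons_succ, totalDegree_X]

/-- The conditions on `q` and `t` that are needed for interpolation. -/
structure Generic (q t : k) : Prop where
  q_ne : q ≠ 0
  t_ne : t ≠ 0
  pow_ne : ∀ m b : ℤ, m ≠ 0 → q ^ m ≠ t ^ b

theorem Generic.eq_zero_of_bar_eq {q t : k} (h : Generic q t) {n : ℕ} {v : Fin n → ℤ} {i : Fin n}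
    {b : ℤ} (hv : bar q t v i = t ^ b) : v i = 0 := by
  by_contra h0
  refine h.pow_ne (v i) (b + kIndex v i) h0 ?_
  rw [zpow_add₀ h.t_ne, ← hv, bar, mul_assoc, ← zpow_add₀ h.t_ne]
  simp

theorem bar_castSucc_of_last_eq_zero (q t : k) {n : ℕ} {v : Fin (n + 1) → ℤ} (hv : 0 ≤ v)
    (h : v (Fin.last n) = 0) (i : Fin n) :
    bar q t v i.castSucc = bar q t (fun l : Fin n => v l.castSucc) i := by
  simp only [bar, kIndex_castSucc_of_last_eq_zero hv h]

theorem bar_last_of_eq_zero (q t : k) {n : ℕ} {v : Fin (n + 1) → ℤ} (hv : 0 ≤ v)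
    (h : v (Fin.last n) = 0) : bar q t v (Fin.last n) = t ^ (-(n : ℤ)) := by
  have : kIndex v (Fin.last n) = n := by
    rw [kIndex_eq_sum, Fin.sum_univ_castSucc]
    have h1 : ∀ i : Fin n, 0 ≤ v i.castSucc := fun i => hv _
    simp [h, h1, Fin.castSucc_lt_last]
  simp [bar, h, this]

/-- A polynomial of degree at most `d` that vanishes at the spectral vectors of all compositions of
size at most `d` is zero. -/
theorem eq_zero_of_vanishing [Infinite k] {q t : k} (hqt : Generic q t) {n : ℕ} (d : ℕ)
    {f : MvPolynomial (Fin n) k} (hd : f.totalDegree ≤ d)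
    (hf : ∀ v : Fin n → ℤ, 0 ≤ v → ∑ i, v i ≤ d → eval (bar q t v) f = 0) : f = 0 := by
  induction n generalizing d with
  | zero =>
    refine funext fun x => ?_
    rw [map_zero, ← hf 0 le_rfl (by simp)]
    congr 2
    exact Subsingleton.elim _ _
  | succ n ihn =>
    -- On the hyperplane where the last coordinate is t^(-n), the compositions ending in 0 have the
    -- spectral vectors of compositions with one part fewer, so `ihn` kills the restriction of f.
    have key : ∀ (d : ℕ) (f : MvPolynomial (Fin (n + 1)) k), f.totalDegree ≤ d →
        (∀ v : Fin (n + 1) → ℤ, 0 ≤ v → ∑ i, v i ≤ d → eval (bar q t v) f = 0) →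
        X (Fin.last n) - C (t ^ (-(n : ℤ))) ∣ f := by
      intro d f hd hf
      refine X_sub_C_dvd_of_eval fun x hx => ?_
      set φ : Fin (n + 1) → MvPolynomial (Fin n) k :=
        Fin.snoc (α := fun _ => MvPolynomial (Fin n) k) X (C (t ^ (-(n : ℤ)))) with hφ
      have h0 : bind₁ φ f = 0 := by
        refine ihn d ((totalDegree_bind₁_le (fun i => ?_) f).trans hd) fun v hv hvd => ?_
        · refine Fin.lastCases ?_ (fun i => ?_) i <;> simp [hφ]
        · set w : Fin (n + 1) → ℤ := Fin.snoc (α := fun _ => ℤ) v 0 with hw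
          have hw0 : 0 ≤ w := by
            intro i
            refine Fin.lastCases ?_ (fun i => ?_) i
            · simp [hw]
            · simpa [hw] using hv i
          have hl : w (Fin.last n) = 0 := by simp [hw]
          have hc : (fun l : Fin n => w l.castSucc) = v := by
            funext l
            simp [hw]
          rw [eval_bind₁, ← hf w hw0 (by simpa [Fin.sum_univ_castSucc, hw] using hvd)]
          congr 2
          funext i
          refine Fin.lastCases ?_ (fun i => ?_) i
          · rw [bar_last_of_eq_zero q t hw0 hl]
            simp [hφ]
          · rw [bar_castSucc_of_last_eq_zero q t hw0 hl, hc]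
            simp [hφ]
      have h1 : eval (fun i : Fin n => x i.castSucc) (bind₁ φ f) = 0 := by rw [h0, map_zero]
      rw [eval_bind₁] at h1
      rw [← h1]
      congr 2
      funext i
      refine Fin.lastCases ?_ (fun i => ?_) i
      · simp [hφ, hx]
      · simp [hφ]
    by_contra hne
    induction d generalizing f with
    | zero =>
      obtain ⟨g, rfl⟩ := key _ _ hd hf
      have hg : g ≠ 0 := right_ne_zero_of_mul hne
      rw [totalDegree_mul_of_isDomain (X_sub_C_ne_zero _ _) hg, totalDegree_X_sub_C] at hd
      omega
    | succ d ihd =>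
      obtain ⟨g, rfl⟩ := key _ _ hd hf
      have hg : g ≠ 0 := right_ne_zero_of_mul hne
      rw [totalDegree_mul_of_isDomain (X_sub_C_ne_zero _ _) hg, totalDegree_X_sub_C] at hd
      -- This substitution undoes `unrot`: it turns the conditions on the quotient g at `rot v` into
      -- conditions at v, whose size is smaller by one.
      set φ : Fin (n + 1) → MvPolynomial (Fin (n + 1)) k :=
        Fin.snoc (α := fun _ => MvPolynomial (Fin (n + 1)) k) (fun i : Fin n => X i.succ)
          (C q * X 0) with hφ
      have hev : ∀ x, eval (unrot q x) (bind₁ φ g) = eval x g := by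
        intro x
        rw [eval_bind₁]
        congr 2
        funext i
        refine Fin.lastCases ?_ (fun i => ?_) i
        · simp [hφ, hqt.q_ne]
        · simp [hφ]
      refine ihd (f := bind₁ φ g) ((totalDegree_bind₁_le (fun i => ?_) g).trans (by omega))
        (fun v hv hvd => ?_) fun h => hg (funext fun x => ?_)
      · refine Fin.lastCases ?_ (fun i => ?_) i
        · simp only [hφ, Fin.snoc_last]
          refine (totalDegree_mul _ _).trans ?_
          rw [totalDegree_C, totalDegree_X]
        · simp [hφ]
      · rw [← unrot_bar_rot t hqt.q_ne v, hev]
        have hr : 0 ≤ rot v := by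
          intro i
          refine Fin.lastCases ?_ (fun i => ?_) i
          · have := hv 0
            simp only [Pi.zero_apply, rot_last] at *
            omega
          · simpa using hv i.succ
        have h1 := hf (rot v) hr (by
          rw [Fin.sum_univ_castSucc]
          rw [Fin.sum_univ_succ] at hvd
          simp only [rot_castSucc, rot_last]
          push_cast
          linarith)
        rw [map_mul, mul_eq_zero] at h1
        -- The linear factor can vanish only if the last entry of `rot v` is 0, but that entry is
        -- v_1 + 1.
        refine h1.resolve_left fun h2 => ?_
        rw [map_sub, eval_X, eval_C, sub_eq_zero] at h2
        have h3 := hqt.eq_zero_of_bar_eq h2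
        have := hv 0
        simp only [Pi.zero_apply, rot_last] at *
        omega
      · rw [← hev, h, map_zero, map_zero]

/-! ### Demazure–Lusztig operators -/

theorem X_sub_X_dvd_sub_rename {σ : Type*} [DecidableEq σ] (i j : σ) (f : MvPolynomial σ k) :
    X i - X j ∣ f - rename (Equiv.swap i j) f := by
  induction f using MvPolynomial.induction_on with
  | C a => simp
  | add p q hp hq =>
    rw [map_add, add_sub_add_comm]
    exact dvd_add hp hq
  | mul_X p l hp =>
    rw [map_mul, rename_X]
    have : p * X l - rename (Equiv.swap i j) p * X (Equiv.swap i j l) =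
        (p - rename (Equiv.swap i j) p) * X l +
        rename (Equiv.swap i j) p * (X l - X (Equiv.swap i j l)) := by ring
    rw [this]
    refine dvd_add (hp.mul_right _) (Dvd.dvd.mul_left ?_ _)
    rw [Equiv.swap_apply_def]
    split_ifs with h1 h2
    · rw [h1]
    · rw [h2, ← neg_sub, neg_dvd]
    · simp

/-- The divided difference `(f - s f) / (x_i - x_j)`, where `s` interchanges `x_i` and `x_j`. -/
def dividedDiff {σ : Type*} [DecidableEq σ] (i j : σ) (f : MvPolynomial σ k) : MvPolynomial σ k :=
  (X_sub_X_dvd_sub_rename i j f).choose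

theorem X_sub_X_mul_dividedDiff {σ : Type*} [DecidableEq σ] (i j : σ) (f : MvPolynomial σ k) :
    (X i - X j) * dividedDiff i j f = f - rename (Equiv.swap i j) f :=
  (X_sub_X_dvd_sub_rename i j f).choose_spec.symm

/-- The Demazure–Lusztig operator `f ↦ t (s f) + (t - 1) x_i (f - s f) / (x_i - x_j)`. -/
def hecke (t : k) {σ : Type*} [DecidableEq σ] (i j : σ) (f : MvPolynomial σ k) :
    MvPolynomial σ k :=
  C t * rename (Equiv.swap i j) f + C (t - 1) * (X i * dividedDiff i j f)

/-- With the denominator cleared the identity needs no assumption that the two coordinates differ.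
-/
theorem eval_hecke (t : k) {σ : Type*} [DecidableEq σ] (i j : σ) (f : MvPolynomial σ k)
    (x : σ → k) : (x i - x j) * eval x (hecke t i j f) =
      (t - 1) * x i * eval x f + (x i - t * x j) * eval (x ∘ Equiv.swap i j) f := by
  have h := congrArg (eval x) (X_sub_X_mul_dividedDiff i j f)
  simp only [map_mul, map_sub, eval_X, eval_rename] at h
  simp only [hecke, map_mul, map_add, eval_X, eval_rename, eval_C]
  linear_combination (t - 1) * x i * h

theorem eval_hecke_of_eq_zero (t : k) {σ : Type*} [DecidableEq σ] {i j : σ}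
    (f : MvPolynomial σ k) {x : σ → k} (hx : x i = 0) :
    eval x (hecke t i j f) = t * eval (x ∘ Equiv.swap i j) f := by
  simp [hecke, hx, eval_rename]

theorem eval_hecke_of_eq_mul {t : k} (ht : t ≠ 1) {σ : Type*} [DecidableEq σ] {i j : σ}
    (f : MvPolynomial σ k) {x : σ → k} (hx : x i = t * x j) (hj : x j ≠ 0) :
    eval x (hecke t i j f) = t * eval x f := by
  have h := eval_hecke t i j f x
  rw [hx, sub_self, zero_mul, add_zero] at h
  have h1 : (t - 1) * x j ≠ 0 := mul_ne_zero (sub_ne_zero.mpr ht) hj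
  apply mul_left_cancel₀ h1
  linear_combination h

/-- The divided difference lowers the degree by one and the factor x_i restores it. -/
theorem totalDegree_hecke_le (t : k) {σ : Type*} [DecidableEq σ] {i j : σ} (hij : i ≠ j)
    (f : MvPolynomial σ k) : (hecke t i j f).totalDegree ≤ f.totalDegree := by
  have hr : (rename (Equiv.swap i j) f).totalDegree ≤ f.totalDegree := totalDegree_rename_le _ _
  refine (totalDegree_add _ _).trans (max_le ?_ ?_)
  · refine (totalDegree_mul _ _).trans ?_
    rwa [totalDegree_C, zero_add]
  · refine (totalDegree_mul _ _).trans ?_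
    rw [totalDegree_C, zero_add]
    by_cases h0 : dividedDiff i j f = 0
    · simp [h0]
    · have h1 := congrArg totalDegree (X_sub_X_mul_dividedDiff i j f)
      have h2 : (X i - X j : MvPolynomial σ k).totalDegree = 1 := by
        refine IsHomogeneous.totalDegree ((isHomogeneous_X k i).sub (isHomogeneous_X k j))
          (X_sub_X_ne_zero hij)
      rw [totalDegree_mul_of_isDomain (X_sub_X_ne_zero hij) h0, h2] at h1
      rw [totalDegree_mul_of_isDomain (X_ne_zero i) h0, totalDegree_X, h1]
      exact (totalDegree_sub _ _).trans (max_le le_rfl hr)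

end Poly

/-! ### Existence and uniqueness of the interpolation polynomials -/

section Existence

variable {k : Type*} [Field k]

theorem IsInterp.eval_ne_zero [Infinite k] {q t : k} (hqt : Generic q t) {n : ℕ} {α : Fin n → ℕ}
    {P : MvPolynomial (Fin n) k} (hP : IsInterp q t α P) :
    eval (bar q t fun i => (α i : ℤ)) P ≠ 0 := by
  intro h0
  have : P = 0 := by
    refine eq_zero_of_vanishing hqt _ hP.1 fun v hv hvd => ?_
    lift v to Fin n → ℕ using hv
    by_cases hα : v = α
    · rw [hα]
      exact h0
    · have hv' : ∑ i, v i ≤ ∑ i, α i := by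
        beta_reduce at hvd
        exact_mod_cast hvd
      exact hP.2.1 v hv' hα
  have h1 := hP.2.2
  rw [this, coeff_zero] at h1
  exact zero_ne_one h1

/-- The interpolation polynomial does not vanish at its own spectral vector, so subtracting a
suitable multiple from Q removes the only value left free; uniqueness makes the difference zero. -/
theorem IsInterp.eq_C_mul [Infinite k] {q t : k} (hqt : Generic q t) {n : ℕ} {α : Fin n → ℕ}
    {P Q : MvPolynomial (Fin n) k} (hP : IsInterp q t α P) (hd : Q.totalDegree ≤ ∑ i, α i)
    (hQ : ∀ β : Fin n → ℕ, ∑ i, β i ≤ ∑ i, α i → β ≠ α →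
      eval (bar q t fun i => (β i : ℤ)) Q = 0) :
    Q = C (coeff (Finsupp.equivFunOnFinite.symm α) Q) * P := by
  obtain ⟨c, hc⟩ : ∃ c, Q = C c * P := by
    refine ⟨eval (bar q t fun i => (α i : ℤ)) Q / eval (bar q t fun i => (α i : ℤ)) P, ?_⟩
    rw [← sub_eq_zero]
    refine eq_zero_of_vanishing hqt (∑ i, α i) ?_ fun v hv hvd => ?_
    · refine (totalDegree_sub _ _).trans (max_le hd ((totalDegree_mul _ _).trans ?_))
      rw [totalDegree_C, zero_add]
      exact hP.1
    lift v to Fin n → ℕ using hv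
    rw [map_sub, map_mul, eval_C]
    by_cases hα : v = α
    · rw [hα, div_mul_cancel₀ _ (hP.eval_ne_zero hqt), sub_self]
    · have hv' : ∑ i, v i ≤ ∑ i, α i := by
        beta_reduce at hvd
        exact_mod_cast hvd
      have h1 := hP.2.1 v hv' hα
      have h2 := hQ v hv' hα
      rw [h1, h2, mul_zero, sub_self]
  rw [hc, coeff_C_mul, hP.2.2, mul_one]

theorem IsInterp.unique [Infinite k] {q t : k} (hqt : Generic q t) {n : ℕ} {α : Fin n → ℕ}
    {P Q : MvPolynomial (Fin n) k} (hP : IsInterp q t α P) (hQ : IsInterp q t α Q) : Q = P := by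
  rw [hP.eq_C_mul hqt hQ.1 hQ.2.1, hQ.2.2, map_one, one_mul]

/-- The interpolation polynomial for `t = 1`. -/
def prodInterp (q : k) {n : ℕ} (α : Fin n → ℕ) : MvPolynomial (Fin n) k :=
  ∏ i, ∏ j ∈ Finset.range (α i), (X i - C (q ^ j))

theorem totalDegree_prodInterp_le (q : k) {n : ℕ} (α : Fin n → ℕ) :
    (prodInterp q α).totalDegree ≤ ∑ i, α i := by
  refine (totalDegree_finsetProd _ _).trans (Finset.sum_le_sum fun i _ => ?_)
  refine (totalDegree_finsetProd _ _).trans ?_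
  simp only [totalDegree_X_sub_C]
  simp

/-- x^α is the lexicographic leading monomial of a product of monic factors. -/
theorem coeff_prodInterp (q : k) {n : ℕ} (α : Fin n → ℕ) :
    coeff (Finsupp.equivFunOnFinite.symm α) (prodInterp q α) = 1 := by
  have h1 : ∀ i : Fin n, MonomialOrder.lex.degree
      (∏ j ∈ Finset.range (α i), (X i - C (q ^ j)) : MvPolynomial (Fin n) k) =
      Finsupp.single i (α i) := by
    intro i
    rw [MonomialOrder.degree_prod fun j _ => X_sub_C_ne_zero i (q ^ j)]
    simp only [MonomialOrder.degree_X_sub_C, Finset.sum_const, Finset.card_range]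
    simp
  have h2 : ∀ i : Fin n, MonomialOrder.lex.Monic
      (∏ j ∈ Finset.range (α i), (X i - C (q ^ j)) : MvPolynomial (Fin n) k) := fun i =>
    MonomialOrder.Monic.prod fun j _ => MonomialOrder.monic_X_sub_C _ i (q ^ j)
  have h3 : MonomialOrder.lex.degree (prodInterp q α) = Finsupp.equivFunOnFinite.symm α := by
    rw [prodInterp, MonomialOrder.degree_prod fun i _ =>
      Finset.prod_ne_zero_iff.mpr fun j _ => X_sub_C_ne_zero i (q ^ j)]
    simp only [h1]
    ext i
    simp [Finsupp.finsetSum_apply, Finsupp.single_apply]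
  rw [← h3]
  exact MonomialOrder.Monic.prod fun i _ => h2 i

/-- The size condition forces β_i < α_i for some i, and then the factor x_i - q^(β_i) is present. -/
theorem eval_prodInterp_eq_zero (q : k) {n : ℕ} {α β : Fin n → ℕ}
    (hβ : ∑ i, β i ≤ ∑ i, α i) (hne : β ≠ α) :
    eval (bar q 1 fun i => (β i : ℤ)) (prodInterp q α) = 0 := by
  obtain ⟨i, hi⟩ : ∃ i, β i < α i := by
    by_contra! h
    refine hne (funext fun i => ?_)
    by_contra hi
    have : ∑ i, α i < ∑ i, β i :=
      Finset.sum_lt_sum (fun i _ => h i) ⟨i, Finset.mem_univ i, lt_of_le_of_ne (h i) (Ne.symm hi)⟩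
    omega
  rw [prodInterp, map_prod]
  refine Finset.prod_eq_zero (Finset.mem_univ i) ?_
  rw [map_prod]
  refine Finset.prod_eq_zero (Finset.mem_range.mpr hi) ?_
  simp [bar]

theorem isInterp_prodInterp (q : k) {n : ℕ} (α : Fin n → ℕ) :
    IsInterp q 1 α (prodInterp q α) :=
  ⟨totalDegree_prodInterp_le q α, fun _ h h' => eval_prodInterp_eq_zero q h h',
    coeff_prodInterp q α⟩

/-- The exponent vectors of size at most `d`. -/
abbrev SmallComp (n d : ℕ) : Type := {γ : Fin n → ℕ // ∑ i, γ i ≤ d}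

instance (n d : ℕ) : Finite (SmallComp n d) := by
  refine Finite.of_injective
    (fun (γ : SmallComp n d) (i : Fin n) => (⟨γ.1 i, Nat.lt_succ_of_le (le_trans
      (Finset.single_le_sum (fun _ _ => Nat.zero_le _) (Finset.mem_univ i)) γ.2)⟩ : Fin (d + 1)))
    fun γ δ h => ?_
  ext i
  exact congrArg Fin.val (congrFun h i)

instance (n d : ℕ) : Fintype (SmallComp n d) := Fintype.ofFinite _

/-- The polynomial with given coefficients. -/
def ofCoeffs {n d : ℕ} (c : SmallComp n d → k) : MvPolynomial (Fin n) k :=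
  ∑ γ, monomial (Finsupp.equivFunOnFinite.symm γ.1) (c γ)

theorem totalDegree_ofCoeffs_le {n d : ℕ} (c : SmallComp n d → k) :
    (ofCoeffs c).totalDegree ≤ d := by
  refine totalDegree_finsetSum_le fun γ _ => ?_
  refine (totalDegree_monomial_le _ _).trans ?_
  rw [Finsupp.sum_fintype _ _ (fun _ => rfl)]
  simpa using γ.2

theorem coeff_ofCoeffs {n d : ℕ} (c : SmallComp n d → k) (γ : SmallComp n d) :
    coeff (Finsupp.equivFunOnFinite.symm γ.1) (ofCoeffs c) = c γ := by
  classical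
  rw [ofCoeffs, coeff_sum, Finset.sum_eq_single γ]
  · simp
  · intro δ _ h
    rw [coeff_monomial, if_neg]
    intro h'
    exact h (Subtype.ext (Finsupp.equivFunOnFinite.symm.injective h'))
  · simp

theorem eval_ofCoeffs {n d : ℕ} (c : SmallComp n d → k) (x : Fin n → k) :
    eval x (ofCoeffs c) = ∑ γ : SmallComp n d, (∏ i, x i ^ γ.1 i) * c γ := by
  rw [ofCoeffs, map_sum]
  refine Finset.sum_congr rfl fun γ _ => ?_
  rw [eval_monomial, Finsupp.prod_fintype _ _ (fun _ => pow_zero _), mul_comm]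
  rfl

open Classical in
/-- The interpolation conditions for the composition `α`, in rescaled coordinates. -/
def interpMatrix {R : Type*} [CommRing R] (q t : R) {n d : ℕ} (α : SmallComp n d) :
    Matrix (SmallComp n d) (SmallComp n d) R := fun β γ =>
  if β = α then (if γ = α then 1 else 0)
  else ∏ i, (q ^ β.1 i * t ^ (2 * n - kIndex (fun i => (β.1 i : ℤ)) i)) ^ γ.1 i

theorem map_interpMatrix {R S : Type*} [CommRing R] [CommRing S] (φ : R →+* S) (q t : R)
    {n d : ℕ} (α : SmallComp n d) :
    (interpMatrix q t α).map φ = interpMatrix (φ q) (φ t) α := by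
  ext β γ
  simp only [interpMatrix, Matrix.map_apply]
  split_ifs <;> simp

/-- Guarantees that the natural subtraction in `interpMatrix` never truncates. The factor t^(2n)
there keeps all entries polynomial in q and t, so that t can be specialised. -/
theorem kIndex_le {n : ℕ} (v : Fin n → ℤ) (i : Fin n) : kIndex v i ≤ 2 * n := by
  rw [kIndex, two_mul]
  refine add_le_add ?_ ?_ <;> exact (Finset.card_filter_le _ _).trans (by simp)

/-- Rescaling of coefficients. -/
def rescale (t : k) {n d : ℕ} (c : SmallComp n d → k) : SmallComp n d → k :=
  fun γ => (t ^ (2 * n)) ^ (∑ i, γ.1 i) * c γ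

theorem interpMatrix_mulVec {q t : k} (ht : t ≠ 0) {n d : ℕ} (α β : SmallComp n d)
    (c : SmallComp n d → k) (h : β ≠ α) : (interpMatrix q t α).mulVec c β =
      eval (bar q t fun i => (β.1 i : ℤ)) (ofCoeffs (rescale t c)) := by
  rw [eval_ofCoeffs, Matrix.mulVec, dotProduct]
  refine Finset.sum_congr rfl fun γ _ => ?_
  rw [interpMatrix, if_neg h, rescale, ← mul_assoc, ← Finset.prod_pow_eq_pow_sum,
    ← Finset.prod_mul_distrib]
  congr 1
  refine Finset.prod_congr rfl fun i _ => ?_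
  rw [← mul_pow, bar, mul_assoc, zpow_natCast, pow_sub₀ t ht (kIndex_le _ i), zpow_neg,
    zpow_natCast, mul_comm (t ^ (2 * n))]

theorem interpMatrix_mulVec_self {q t : k} {n d : ℕ} (α : SmallComp n d)
    (c : SmallComp n d → k) : (interpMatrix q t α).mulVec c α = c α := by
  classical
  simp [interpMatrix, Matrix.mulVec, dotProduct]

open Classical in
-- A kernel vector is the coefficient vector of a polynomial with all the required zeros and
-- coefficient 0 at x^α. Being a multiple of `prodInterp`, it is zero.
theorem det_interpMatrix_one_ne_zero [Infinite k] {q : k} (hq : Generic q 1) {n : ℕ}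
    (α : Fin n → ℕ) :
    (interpMatrix q 1 (⟨α, le_rfl⟩ : SmallComp n (∑ i, α i))).det ≠ 0 := by
  intro h0
  obtain ⟨c, hc, h⟩ := Matrix.exists_mulVec_eq_zero_iff.mpr h0
  refine hc ?_
  have hr : rescale (1 : k) c = c := by
    funext γ
    simp [rescale]
  have h1 : ofCoeffs c = 0 := by
    rw [(isInterp_prodInterp q α).eq_C_mul hq (totalDegree_ofCoeffs_le c) ?_]
    · have : coeff (Finsupp.equivFunOnFinite.symm α) (ofCoeffs c) = 0 := by
        rw [coeff_ofCoeffs c ⟨α, le_rfl⟩, ← interpMatrix_mulVec_self (q := q) (t := 1) _ c, h]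
        rfl
      rw [this, map_zero, zero_mul]
    · intro β hβ hne
      have := interpMatrix_mulVec (q := q) one_ne_zero (⟨α, le_rfl⟩ : SmallComp n (∑ i, α i))
        ⟨β, hβ⟩ c (fun h => hne (congrArg Subtype.val h))
      rw [hr] at this
      rw [← this, h]
      rfl
  funext γ
  rw [← coeff_ofCoeffs c γ, h1, coeff_zero]
  rfl

open Classical in
theorem exists_isInterp_of_det_ne_zero {q t : k} (ht : t ≠ 0) {n : ℕ} (α : Fin n → ℕ)
    (h : (interpMatrix q t (⟨α, le_rfl⟩ : SmallComp n (∑ i, α i))).det ≠ 0) :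
    ∃ P, IsInterp q t α P := by
  set a : SmallComp n (∑ i, α i) := ⟨α, le_rfl⟩ with ha
  set M := interpMatrix q t a with hM
  -- `rescale` multiplies the coefficient at α by s, so the linear system is solved with s⁻¹ on the
  -- right.
  set s : k := (t ^ (2 * n)) ^ (∑ i, α i) with hs
  have hs0 : s ≠ 0 := pow_ne_zero _ (pow_ne_zero _ ht)
  set c := M⁻¹.mulVec (Pi.single a s⁻¹) with hc
  have hMc : M.mulVec c = Pi.single a s⁻¹ := by
    rw [hc, Matrix.mulVec_mulVec, Matrix.mul_nonsing_inv _ (isUnit_iff_ne_zero.mpr h),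
      Matrix.one_mulVec]
  refine ⟨ofCoeffs (rescale t c), totalDegree_ofCoeffs_le _, fun β hβ hne => ?_, ?_⟩
  · have hne' : (⟨β, hβ⟩ : SmallComp n (∑ i, α i)) ≠ a := fun h => hne (congrArg Subtype.val h)
    have := interpMatrix_mulVec (q := q) ht a ⟨β, hβ⟩ c hne'
    rw [← this, ← hM, hMc, Pi.single_eq_of_ne hne']
  · have h1 : c a = s⁻¹ := by
      rw [← interpMatrix_mulVec_self (q := q) (t := t) a c, ← hM, hMc, Pi.single_eq_same]
    rw [coeff_ofCoeffs (rescale t c) a, rescale, h1]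
    exact mul_inv_cancel₀ hs0

theorem generic_two_one : Generic (2 : ℚ) 1 where
  q_ne := two_ne_zero
  t_ne := one_ne_zero
  pow_ne m b hm := by
    rw [one_zpow]
    intro h
    exact hm ((zpow_eq_one_iff_right₀ (by norm_num) (by norm_num)).mp h)

theorem algebraMap_BaseF_injective :
    Function.Injective (algebraMap (MvPolynomial (Fin 2) ℚ) BaseF) :=
  IsFractionRing.injective _ _

theorem tF_ne_zero : tF ≠ 0 := by
  rw [tF, map_ne_zero_iff _ algebraMap_BaseF_injective]
  exact X_ne_zero _

theorem qF_ne_zero : qF ≠ 0 := by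
  rw [qF, map_ne_zero_iff _ algebraMap_BaseF_injective]
  exact X_ne_zero _

/-- The determinant comes from the polynomial ring ℚ[q, t], and it is nonzero because its value at q
= 2, t = 1 is. -/
theorem exists_isInterp {n : ℕ} (α : Fin n → ℕ) : ∃ P, IsInterp qF tF α P := by
  classical
  refine exists_isInterp_of_det_ne_zero tF_ne_zero α ?_
  rw [qF, tF, ← map_interpMatrix, ← RingHom.mapMatrix_apply, ← RingHom.map_det,
    map_ne_zero_iff _ algebraMap_BaseF_injective]
  intro h
  refine det_interpMatrix_one_ne_zero generic_two_one α ?_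
  have := congrArg (eval ![(2 : ℚ), 1]) h
  rw [RingHom.map_det, RingHom.mapMatrix_apply, map_interpMatrix] at this
  simpa using this

theorem qF_pow_mul_tF_pow_inj {a b c d : ℕ} (h : qF ^ a * tF ^ b = qF ^ c * tF ^ d) :
    a = c ∧ b = d := by
  simp only [qF, tF, ← map_pow, ← map_mul] at h
  have h1 := algebraMap_BaseF_injective h
  have h2 : ∀ a b : ℕ, (X 0 ^ a * X 1 ^ b : MvPolynomial (Fin 2) ℚ) =
      monomial (Finsupp.single 0 a + Finsupp.single 1 b) 1 := by
    intro a b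
    rw [X_pow_eq_monomial, X_pow_eq_monomial, monomial_mul, one_mul]
  rw [h2, h2] at h1
  have h3 := (monomial_left_inj (one_ne_zero (α := ℚ))).mp h1
  exact ⟨by simpa using DFunLike.congr_fun h3 0, by simpa using DFunLike.congr_fun h3 1⟩

theorem qF_zpow_mul_tF_zpow_eq_one {a b : ℤ} (h : qF ^ a * tF ^ b = 1) : a = 0 ∧ b = 0 := by
  have h1 : qF ^ (a.toNat) * tF ^ (b.toNat) = qF ^ ((-a).toNat) * tF ^ ((-b).toNat) := by
    have e : ∀ (x : BaseF) (hx : x ≠ 0) (a : ℤ), x ^ a.toNat = x ^ (-a).toNat * x ^ a := by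
      intro x hx a
      rw [← zpow_natCast, ← zpow_natCast, ← zpow_add₀ hx]
      congr 1
      omega
    rw [e _ qF_ne_zero, e _ tF_ne_zero]
    linear_combination (qF ^ ((-a).toNat) * tF ^ ((-b).toNat)) * h
  obtain ⟨h2, h3⟩ := qF_pow_mul_tF_pow_inj h1
  omega

theorem generic_qF_tF : Generic qF tF where
  q_ne := qF_ne_zero
  t_ne := tF_ne_zero
  pow_ne m b hm h := by
    refine hm (qF_zpow_mul_tF_zpow_eq_one (a := m) (b := -b) ?_).1
    rw [h, ← zpow_add₀ tF_ne_zero]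
    simp

theorem isInterp_polyG {n : ℕ} (α : Fin n → ℕ) : IsInterp qF tF α (polyG α) := by
  rw [polyG, dif_pos (exists_isInterp α)]
  exact (exists_isInterp α).choose_spec

instance : CharZero BaseF :=
  charZero_of_injective_algebraMap algebraMap_BaseF_injective

theorem isInterp_iff {n : ℕ} (α : Fin n → ℕ) (P : MvPolynomial (Fin n) BaseF) :
    IsInterp qF tF α P ↔ P = polyG α := by
  constructor
  · intro h
    exact (isInterp_polyG α).unique generic_qF_tF h
  · rintro rfl
    exact isInterp_polyG α

end Existence

/-! ### Relations between interpolation polynomials -/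

section Family

variable {k : Type*} [Field k]

theorem comp_swap_nonneg {n : ℕ} {v : Fin n → ℤ} (hv : 0 ≤ v) (i j : Fin n) :
    0 ≤ v ∘ Equiv.swap i j := fun l => hv (Equiv.swap i j l)

theorem sum_comp_swap {n : ℕ} (v : Fin n → ℤ) (i j : Fin n) :
    ∑ l, (v ∘ Equiv.swap i j) l = ∑ l, v l :=
  Equiv.sum_comp (Equiv.swap i j) v

theorem comp_swap_swap {n : ℕ} {α : Type*} (v : Fin n → α) (i j : Fin n) :
    (v ∘ Equiv.swap i j) ∘ Equiv.swap i j = v := by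
  funext l
  simp

theorem comp_swap_of_eq {n : ℕ} {α : Type*} {v : Fin n → α} {i j : Fin n} (h : v i = v j) :
    v ∘ Equiv.swap i j = v := by
  funext l
  simp only [Function.comp_apply, Equiv.swap_apply_def]
  split_ifs with h1 h2
  · rw [h1, h]
  · rw [h2, h]
  · rfl

/-- Deleting the second of two adjacent coordinates after transposing them amounts to deleting the
first one before; this moves the chain in `exists_hecke_chain` by one position. -/
theorem comp_swap_succAbove {n : ℕ} {α : Type*} (x : Fin (n + 1) → α) (i : Fin n) :
    (fun l => (x ∘ Equiv.swap i.castSucc i.succ) (i.succ.succAbove l)) =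
      fun l => x (i.castSucc.succAbove l) := by
  funext l
  simp only [Function.comp_apply]
  congr 1
  simp only [Fin.succAbove, Equiv.swap_apply_def, Fin.lt_def, Fin.ext_iff]
  split_ifs <;> simp_all <;> omega

theorem tau_castSucc {t : k} {n : ℕ} (ht : t ≠ 0) (i : Fin n) :
    tau t (n + 1) i.castSucc = t * tau t (n + 1) i.succ := by
  simp only [tau, Fin.val_castSucc, Fin.val_succ]
  rw [← zpow_one_add₀ ht]
  congr 1
  push_cast
  ring

theorem tau_of_adj {t : k} {n : ℕ} (ht : t ≠ 0) {i j : Fin n} (hij : (j : ℕ) = i + 1) :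
    tau t n i = t * tau t n j := by
  simp only [tau, hij]
  rw [← zpow_one_add₀ ht]
  congr 1
  push_cast
  ring

theorem tau_ne_zero {t : k} {n : ℕ} (ht : t ≠ 0) (i : Fin n) : tau t n i ≠ 0 := zpow_ne_zero _ ht

theorem rot_nonneg {n : ℕ} {v : Fin (n + 1) → ℤ} (hv : 0 ≤ v) : 0 ≤ rot v := by
  intro i
  refine Fin.lastCases ?_ (fun i => ?_) i
  · have := hv 0
    simp only [Pi.zero_apply, rot_last] at *
    omega
  · simpa using hv i.succ

theorem sum_rot {n : ℕ} (v : Fin (n + 1) → ℤ) : ∑ i, rot v i = ∑ i, v i + 1 := by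
  rw [Fin.sum_univ_castSucc, Fin.sum_univ_succ]
  simp only [rot_castSucc, rot_last]
  ring

theorem exists_rot {n : ℕ} {w : Fin (n + 1) → ℤ} (hw : 0 ≤ w) (h : w (Fin.last n) ≠ 0) :
    ∃ v, 0 ≤ v ∧ rot v = w := by
  refine ⟨Fin.cons (α := fun _ => ℤ) (w (Fin.last n) - 1) fun i : Fin n => w i.castSucc,
    fun i => ?_, funext fun i => ?_⟩
  · refine Fin.cases ?_ (fun i => ?_) i
    · have := hw (Fin.last n)
      simp only [Pi.zero_apply, Fin.cons_zero] at *
      omega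
    · simpa using hw i.castSucc
  · refine Fin.lastCases ?_ (fun i => ?_) i <;> simp

/-- All compositions are obtained from `0` by adjacent transpositions and cyclic raising. -/
theorem comp_induction {n : ℕ} {P : (Fin (n + 1) → ℤ) → Prop} (zero : P 0)
    (swap : ∀ v, 0 ≤ v → ∀ i j : Fin (n + 1), (j : ℕ) = i + 1 → P v → P (v ∘ Equiv.swap i j))
    (rotate : ∀ v, 0 ≤ v → P v → P (rot v)) {v : Fin (n + 1) → ℤ} (hv : 0 ≤ v) : P v := by
  have perm : ∀ (σ : Equiv.Perm (Fin (n + 1))) (v : Fin (n + 1) → ℤ), 0 ≤ v → P v → P (v ∘ σ) := by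
    intro σ
    have hσ : σ ∈ Submonoid.closure
        (Set.range fun i : Fin n => Equiv.swap i.castSucc i.succ) := by
      rw [Equiv.Perm.mclosure_swap_castSucc_succ]
      trivial
    induction hσ using Submonoid.closure_induction with
    | mem σ hσ =>
      obtain ⟨i, rfl⟩ := hσ
      exact fun v hv h => swap v hv _ _ (by simp) h
    | one => exact fun v _ h => h
    | mul σ ρ _ _ h1 h2 =>
      exact fun v hv h => h2 (v ∘ σ) (fun l => hv (σ l)) (h1 v hv h)
  obtain ⟨d, hd⟩ : ∃ d : ℕ, ∑ i, v i = d := by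
    have : 0 ≤ ∑ i, v i := Finset.sum_nonneg fun i _ => hv i
    exact ⟨(∑ i, v i).toNat, by omega⟩
  induction d generalizing v with
  | zero =>
    have : v = 0 := by
      funext i
      exact (Finset.sum_eq_zero_iff_of_nonneg fun i _ => hv i).mp (by exact_mod_cast hd) i
        (Finset.mem_univ i)
    rwa [this]
  | succ d ih =>
    obtain ⟨i, hi⟩ : ∃ i, v i ≠ 0 := by
      by_contra! h
      simp only [h, Finset.sum_const_zero] at hd
      omega
    -- A nonzero entry is moved to the last place, where `rot` can be undone.
    rw [← comp_swap_swap v i (Fin.last n)]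
    refine perm _ _ (comp_swap_nonneg hv _ _) ?_
    obtain ⟨u, hu, hur⟩ := exists_rot (comp_swap_nonneg hv i (Fin.last n)) (by simpa using hi)
    rw [← hur]
    refine rotate u hu (ih hu ?_)
    have h1 := sum_rot u
    rw [hur, sum_comp_swap, hd] at h1
    push_cast at h1
    linarith

theorem Generic.bar_ne_of_ne {q t : k} (hqt : Generic q t) {n : ℕ} {v : Fin n → ℤ} {i j : Fin n}
    (h : v i ≠ v j) (b : ℤ) : bar q t v i ≠ t ^ b * bar q t v j := by
  intro h'
  refine hqt.pow_ne (v i - v j) (b - kIndex v j + kIndex v i) (sub_ne_zero.mpr h) ?_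
  rw [zpow_sub₀ hqt.q_ne, div_eq_iff (zpow_ne_zero _ hqt.q_ne), zpow_add₀ hqt.t_ne,
    zpow_sub₀ hqt.t_ne]
  simp only [bar, zpow_neg] at h'
  have h1 := zpow_ne_zero (kIndex v i) hqt.t_ne
  have h2 := zpow_ne_zero (kIndex v j) hqt.t_ne
  have h3 := hqt.t_ne
  field_simp at h' ⊢
  linear_combination h'

theorem Generic.bar_sub_ne_zero {q t : k} (hqt : Generic q t) (ht : t ≠ 1) {n : ℕ}
    (v : Fin n → ℤ) {i j : Fin n} (hij : (j : ℕ) = i + 1) : bar q t v i - bar q t v j ≠ 0 := by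
  rw [sub_ne_zero]
  by_cases h : v i = v j
  · rw [bar_of_eq q hqt.t_ne hij h]
    intro h'
    exact ht (mul_right_cancel₀ (bar_ne_zero hqt.q_ne hqt.t_ne v j) (by rw [h', one_mul]))
  · simpa using hqt.bar_ne_of_ne h 0

/-- If v_i = v_j, swapping coordinates does not give a spectral vector, but then v̄_i = t v̄_j and
the coefficient of that term vanishes. -/
theorem eval_bar_hecke {q t : k} (hqt : Generic q t) {n : ℕ} {i j : Fin n}
    (hij : (j : ℕ) = i + 1) (v : Fin n → ℤ) (f : MvPolynomial (Fin n) k) :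
    (bar q t v i - bar q t v j) * eval (bar q t v) (hecke t i j f) =
      (t - 1) * bar q t v i * eval (bar q t v) f +
        (bar q t v i - t * bar q t v j) * eval (bar q t (v ∘ Equiv.swap i j)) f := by
  rw [eval_hecke]
  by_cases h : v i = v j
  · rw [bar_of_eq q hqt.t_ne hij h]
    ring
  · rw [bar_comp_swap q t hij h]

/-- A family of nonzero polynomials with the vanishing and degree conditions of the interpolation
polynomials; only its values at nonnegative vectors matter. -/
structure IsFamily (q t : k) {n : ℕ} (g : (Fin n → ℤ) → MvPolynomial (Fin n) k) : Prop where
  degree_le : ∀ v, 0 ≤ v → ((g v).totalDegree : ℤ) ≤ ∑ i, v i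
  vanish : ∀ v w, 0 ≤ v → 0 ≤ w → ∑ i, w i ≤ ∑ i, v i → w ≠ v → eval (bar q t w) (g v) = 0
  ne_zero : ∀ v, 0 ≤ v → g v ≠ 0

theorem eq_zero_of_vanishing_int [Infinite k] {q t : k} (hqt : Generic q t) {n : ℕ} (d : ℤ)
    {f : MvPolynomial (Fin n) k} (hd : (f.totalDegree : ℤ) ≤ d)
    (hf : ∀ v : Fin n → ℤ, 0 ≤ v → ∑ i, v i ≤ d → eval (bar q t v) f = 0) : f = 0 :=
  eq_zero_of_vanishing hqt d.toNat (by omega) fun v hv hvd => hf v hv (by omega)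

variable [Infinite k] {q t : k} (hqt : Generic q t) {n : ℕ}
  {g : (Fin n → ℤ) → MvPolynomial (Fin n) k} (hg : IsFamily q t g)

include hqt hg in
theorem IsFamily.eval_bar_ne_zero {v : Fin n → ℤ} (hv : 0 ≤ v) :
    eval (bar q t v) (g v) ≠ 0 := by
  intro h
  refine hg.ne_zero v hv (eq_zero_of_vanishing_int hqt _ (hg.degree_le v hv) fun w hw hwd => ?_)
  by_cases hwv : w = v
  · rw [hwv, h]
  · exact hg.vanish v w hv hw hwd hwv

include hqt hg in
theorem IsFamily.exists_eq_C_mul {v : Fin n → ℤ} (hv : 0 ≤ v) {f : MvPolynomial (Fin n) k}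
    (hd : (f.totalDegree : ℤ) ≤ ∑ i, v i)
    (hf : ∀ w, 0 ≤ w → ∑ i, w i ≤ ∑ i, v i → w ≠ v → eval (bar q t w) f = 0) :
    ∃ c, f = C c * g v := by
  have h0 := hg.eval_bar_ne_zero hqt hv
  refine ⟨eval (bar q t v) f / eval (bar q t v) (g v), ?_⟩
  rw [← sub_eq_zero]
  refine eq_zero_of_vanishing_int hqt (∑ i, v i) ?_ fun w hw hwd => ?_
  · have h1 := totalDegree_sub f (C (eval (bar q t v) f / eval (bar q t v) (g v)) * g v)
    have h2 := totalDegree_mul (C (eval (bar q t v) f / eval (bar q t v) (g v))) (g v)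
    rw [totalDegree_C, zero_add] at h2
    have h3 := hg.degree_le v hv
    have h4 : max f.totalDegree _ ≤ max f.totalDegree (g v).totalDegree := max_le_max le_rfl h2
    have h5 : ((max f.totalDegree (g v).totalDegree : ℕ) : ℤ) ≤ ∑ i, v i := by
      rw [Nat.cast_max]
      exact max_le hd h3
    omega
  · rw [map_sub, map_mul, eval_C]
    by_cases hwv : w = v
    · rw [hwv, div_mul_cancel₀ _ h0, sub_self]
    · rw [hf w hw hwd hwv, hg.vanish v w hv hw hwd hwv, mul_zero, sub_self]

include hqt hg in
-- The coefficient of g v is chosen to cancel the value of `hecke t i j (g v)` at v̄. The remainder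
-- can then be nonzero only at the transposed composition.
theorem IsFamily.exists_hecke_eq (ht : t ≠ 1) {v : Fin n → ℤ} (hv : 0 ≤ v) {i j : Fin n}
    (hij : (j : ℕ) = i + 1) : ∃ c, hecke t i j (g v) =
      C ((t - 1) * bar q t v i / (bar q t v i - bar q t v j)) * g v +
        C c * g (v ∘ Equiv.swap i j) := by
  have hne : i ≠ j := by
    rintro rfl
    omega
  set A := (t - 1) * bar q t v i / (bar q t v i - bar q t v j) with hA
  obtain ⟨c, hc⟩ := hg.exists_eq_C_mul hqt (comp_swap_nonneg hv i j)
    (f := hecke t i j (g v) - C A * g v) (by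
    rw [sum_comp_swap]
    refine le_trans ?_ (hg.degree_le v hv)
    refine Int.ofNat_le.mpr ((totalDegree_sub _ _).trans (max_le (totalDegree_hecke_le t hne _) ?_))
    refine (totalDegree_mul _ _).trans ?_
    rw [totalDegree_C, zero_add]) (by
    intro w hw hwd hwv
    rw [sum_comp_swap] at hwd
    have h0 := hqt.bar_sub_ne_zero ht w hij
    apply mul_left_cancel₀ h0
    rw [map_sub, mul_sub, eval_bar_hecke hqt hij, map_mul, eval_C]
    have h1 : eval (bar q t (w ∘ Equiv.swap i j)) (g v) = 0 := by
      refine hg.vanish v _ hv (comp_swap_nonneg hw i j) (by rwa [sum_comp_swap]) fun h => hwv ?_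
      rw [← h, comp_swap_swap]
    rw [h1]
    by_cases h : w = v
    · rw [hA, h]
      rw [h] at h0
      field_simp
      ring
    · rw [hg.vanish v w hv hw hwd h]
      ring)
  exact ⟨c, by rw [← hc]; ring⟩

end Family

/-! ### Cyclic raising and the inhomogeneous Cherednik operator -/

section Cyclic

variable {k : Type*} [Field k] {q t : k} {n : ℕ}

/-- The raising operator `f ↦ (x_n - t ^ (1 - n)) f(x_n / q, x_1, …, x_{n-1})`, for `n + 1`
variables. -/
def raise (q t : k) (f : MvPolynomial (Fin (n + 1)) k) : MvPolynomial (Fin (n + 1)) k :=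
  (X (Fin.last n) - C (t ^ (-(n : ℤ)))) * unrotPoly q f

theorem eval_raise (f : MvPolynomial (Fin (n + 1)) k) (x : Fin (n + 1) → k) :
    eval x (raise q t f) = (x (Fin.last n) - t ^ (-(n : ℤ))) * eval (unrot q x) f := by
  rw [raise, map_mul, eval_unrotPoly, map_sub, eval_X, eval_C]

theorem totalDegree_raise_le (f : MvPolynomial (Fin (n + 1)) k) :
    (raise q t f).totalDegree ≤ f.totalDegree + 1 := by
  refine (totalDegree_mul _ _).trans ?_
  rw [totalDegree_X_sub_C, add_comm]
  exact Nat.add_le_add_right (totalDegree_unrotPoly_le q f) 1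

theorem eval_bar_raise_eq_zero (hq : q ≠ 0) {f : MvPolynomial (Fin (n + 1)) k}
    {w : Fin (n + 1) → ℤ} (hw : 0 ≤ w)
    (h : ∀ u, 0 ≤ u → rot u = w → eval (bar q t u) f = 0) :
    eval (bar q t w) (raise q t f) = 0 := by
  rw [eval_raise]
  by_cases h0 : w (Fin.last n) = 0
  · rw [bar_last_of_eq_zero q t hw h0, sub_self, zero_mul]
  · obtain ⟨u, hu, rfl⟩ := exists_rot hw h0
    rw [unrot_bar_rot t hq, h u hu rfl, mul_zero]

/-- The polynomial `H_p ⋯ H_{n-1} Φ f`, where `Φ` is the raising operator. -/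
theorem exists_hecke_chain (hqt : Generic q t) (ht : t ≠ 1) {f : MvPolynomial (Fin (n + 1)) k} {d : ℕ}
    (hd : f.totalDegree ≤ d)
    (hf : ∀ u : Fin (n + 1) → ℤ, 0 ≤ u → ∑ i, u i < d → eval (bar q t u) f = 0)
    (p : Fin (n + 1)) : ∃ h : MvPolynomial (Fin (n + 1)) k, h.totalDegree ≤ d + 1 ∧
      (∀ w : Fin (n + 1) → ℤ, 0 ≤ w → ∑ i, w i ≤ d → eval (bar q t w) h = 0) ∧
      (∀ z, z ≠ 0 → eval (fun i => z * tau t (n + 1) i) h =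
        t ^ (-(p : ℤ)) * (z - 1) * eval (unrot q fun i => z * tau t (n + 1) i) f) ∧
      (∀ x : Fin (n + 1) → k, x p = 0 → eval x h =
        -t ^ (-(p : ℤ)) * eval (Fin.cons (α := fun _ => k) 0 fun l => x (p.succAbove l)) f) := by
  induction p using Fin.reverseInduction with
  | last =>
    refine ⟨raise q t f, (totalDegree_raise_le f).trans (by omega), fun w hw hwd => ?_,
      fun z hz => ?_, fun x hx => ?_⟩
    · refine eval_bar_raise_eq_zero hqt.q_ne hw fun u hu huw => hf u hu ?_
      rw [← huw, sum_rot] at hwd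
      linarith
    · rw [eval_raise]
      simp only [tau, Fin.val_last]
      ring
    · rw [eval_raise, hx, zero_sub, Fin.val_last]
      congr 3
      funext l
      refine Fin.cases ?_ (fun l => ?_) l
      · simp [hx]
      · simp
  | cast i ih =>
    obtain ⟨h, h1, h2, h3, h4⟩ := ih
    have hij : ((i.succ : Fin (n + 1)) : ℕ) = i.castSucc + 1 := by simp
    have hp : t ^ (-((i.castSucc : Fin (n + 1)) : ℤ)) =
        t * t ^ (-((i.succ : Fin (n + 1)) : ℤ)) := tau_castSucc hqt.t_ne i
    refine ⟨hecke t i.castSucc i.succ h,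
      (totalDegree_hecke_le t (Fin.castSucc_lt_succ).ne h).trans h1, fun w hw hwd => ?_,
      fun z hz => ?_, fun x hx => ?_⟩
    · apply mul_left_cancel₀ (hqt.bar_sub_ne_zero ht w hij)
      rw [eval_bar_hecke hqt hij, h2 w hw hwd, h2 _ (comp_swap_nonneg hw _ _)
        (by rwa [sum_comp_swap])]
      ring
    -- Adjacent coordinates of zτ have ratio t, so each further operator in the chain contributes
    -- only a factor t.
    · rw [eval_hecke_of_eq_mul ht, h3 z hz, hp]
      · ring
      · rw [tau_castSucc hqt.t_ne]
        ring
      · exact mul_ne_zero hz (tau_ne_zero hqt.t_ne _)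
    -- On x_p = 0 the divided difference drops out, leaving t times the transposition.
    · rw [eval_hecke_of_eq_zero t h hx, h4 _ (by simpa using hx), comp_swap_succAbove, hp]
      ring

variable [Infinite k] (hqt : Generic q t) {g : (Fin (n + 1) → ℤ) → MvPolynomial (Fin (n + 1)) k}
  (hg : IsFamily q t g)

include hqt hg in
-- The linear factor supplies the zeros at compositions ending in 0; every other composition is some
-- `rot u`, where the zero comes from g v at ū.
theorem IsFamily.exists_raise_eq {v : Fin (n + 1) → ℤ} (hv : 0 ≤ v) :
    ∃ c, raise q t (g v) = C c * g (rot v) := by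
  refine hg.exists_eq_C_mul hqt (rot_nonneg hv) ?_ fun w hw hwd hwv => ?_
  · rw [sum_rot]
    have h1 := hg.degree_le v hv
    have h2 := totalDegree_raise_le (q := q) (t := t) (g v)
    omega
  · refine eval_bar_raise_eq_zero hqt.q_ne hw fun u hu huw => ?_
    subst huw
    rw [sum_rot, sum_rot] at hwd
    refine hg.vanish v u hv hu (by linarith) ?_
    rintro rfl
    exact hwv rfl

include hqt hg in
/-- The eigenvalue equation for the inhomogeneous Cherednik operator
`f ↦ x_1⁻¹ (f + H_1 ⋯ H_{n-1} Φ f)`, evaluated at `z τ`. -/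
theorem IsFamily.eval_unrot_tau (ht : t ≠ 1) {v : Fin (n + 1) → ℤ} (hv : 0 ≤ v) {z : k}
    (hz : z ≠ 0) : (z - 1) * eval (unrot q fun i => z * tau t (n + 1) i) (g v) =
      (z * (bar q t v 0)⁻¹ - 1) * eval (fun i => z * tau t (n + 1) i) (g v) := by
  obtain ⟨d, hd⟩ : ∃ d : ℕ, ∑ i, v i = d := by
    have : 0 ≤ ∑ i, v i := Finset.sum_nonneg fun i _ => hv i
    exact ⟨(∑ i, v i).toNat, by omega⟩
  have hdeg := hg.degree_le v hv
  rw [hd] at hdeg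
  obtain ⟨h, h1, h2, h3, h4⟩ := exists_hecke_chain hqt ht (f := g v) (d := d)
    (by exact_mod_cast hdeg) (fun u hu hud => hg.vanish v u hv hu (by linarith) (by
      rintro rfl
      linarith)) 0
  -- D is x_1 times the defect of the eigenvalue equation. It is divisible by x_1 because h = -g v
  -- on x_1 = 0, and the quotient has degree at most d and vanishes at all spectral vectors of size
  -- at most d.
  set D := g v + h - C (bar q t v 0)⁻¹ * (X 0 * g v) with hD
  have hD0 : D = 0 := by
    have hdvd : X 0 - C 0 ∣ D := by
      refine X_sub_C_dvd_of_eval fun x hx => ?_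
      have h5 := h4 x hx
      have h6 : (Fin.cons (α := fun _ => k) 0 fun l : Fin n => x ((0 : Fin (n + 1)).succAbove l)) =
          x := by
        funext l
        refine Fin.cases ?_ (fun l => ?_) l
        · simp [hx]
        · simp
      rw [h6] at h5
      simp only [hD, map_sub, map_add, map_mul, eval_C, eval_X, hx, h5]
      simp
    rw [C_0, sub_zero] at hdvd
    obtain ⟨E, hE⟩ := hdvd
    have hDd : D.totalDegree ≤ d + 1 := by
      have hdeg' : (g v).totalDegree ≤ d := by exact_mod_cast hdeg
      refine (totalDegree_sub _ _).trans (max_le ((totalDegree_add _ _).trans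
        (max_le (by omega) h1)) ?_)
      refine (totalDegree_mul _ _).trans ?_
      rw [totalDegree_C, zero_add]
      refine (totalDegree_mul _ _).trans ?_
      rw [totalDegree_X]
      omega
    have hE0 : E = 0 := by
      by_contra hne
      refine hne (eq_zero_of_vanishing hqt d ?_ fun w hw hwd => ?_)
      · rw [hE, totalDegree_mul_of_isDomain (X_ne_zero _) hne, totalDegree_X] at hDd
        omega
      · have h5 : eval (bar q t w) D = 0 := by
          simp only [hD, map_sub, map_add, map_mul, eval_C, eval_X, h2 w hw hwd]
          by_cases hwv : w = v
          · rw [hwv]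
            have := bar_ne_zero hqt.q_ne hqt.t_ne v 0
            field_simp
            ring
          · rw [hg.vanish v w hv hw (by linarith) hwv]
            ring
        rw [hE, map_mul, eval_X, mul_eq_zero] at h5
        exact h5.resolve_left (bar_ne_zero hqt.q_ne hqt.t_ne w 0)
    rw [hE, hE0, mul_zero]
  have h5 := congrArg (eval fun i => z * tau t (n + 1) i) hD0
  simp only [hD, map_sub, map_add, map_mul, eval_C, eval_X, h3 z hz, map_zero] at h5
  have h6 : tau t (n + 1) 0 = 1 := by simp [tau]
  rw [h6] at h5
  simp only [Fin.val_zero, Nat.cast_zero, neg_zero, zpow_zero] at h5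
  linear_combination h5

end Cyclic

/-! ### Normalised interpolation polynomials -/

section Poch

variable {k : Type*} [Field k]

theorem qPoch_succ (q y : k) (m : ℕ) : qPoch q y (m + 1) = qPoch q y m * (1 - q ^ m * y) := by
  rw [qPoch, Finset.prod_range_succ, ← qPoch]

theorem qPoch_succ' (q y : k) (m : ℕ) : qPoch q y (m + 1) = (1 - y) * qPoch q (q * y) m := by
  rw [qPoch, Finset.prod_range_succ', mul_comm, pow_zero, one_mul, qPoch]
  congr 1
  refine Finset.prod_congr rfl fun j _ => ?_
  ring

theorem one_sub_mul_qPoch (q y : k) (m : ℕ) :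
    (1 - y) * qPoch q (q * y) m = qPoch q y m * (1 - q ^ m * y) := by
  rw [← qPoch_succ', qPoch_succ]

end Poch

section Norm

variable {k : Type*} [Field k]

/-- The conditions on the parameters that are needed for normalised interpolation polynomials. -/
structure GenericTriple (q t a : k) : Prop extends Generic q t where
  t_ne_one : t ≠ 1
  a_ne : a ≠ 0
  a_mul_ne : ∀ m b : ℤ, a * (q ^ m * t ^ b) ≠ 1

namespace GenericTriple

variable {q t a : k} (h : GenericTriple q t a)

include h

theorem mul_bar_inv_ne_one {n : ℕ} (v : Fin n → ℤ) (i : Fin n) (c : ℤ) :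
    q ^ c * a * (bar q t v i)⁻¹ ≠ 1 := by
  have := h.a_mul_ne (c - v i) (kIndex v i)
  rw [zpow_sub₀ h.q_ne] at this
  intro h'
  apply this
  rw [← h', bar, zpow_neg, mul_inv, inv_inv]
  ring

theorem mul_bar_inv_ne_one' {n : ℕ} (v : Fin n → ℤ) (i : Fin n) :
    a * (bar q t v i)⁻¹ - 1 ≠ 0 := by
  simpa [sub_eq_zero] using h.mul_bar_inv_ne_one v i 0

theorem qPoch_ne_zero {n : ℕ} (v : Fin n → ℤ) (i : Fin n) (c : ℤ) (m : ℕ) :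
    qPoch q (q ^ c * a * (bar q t v i)⁻¹) m ≠ 0 := by
  refine Finset.prod_ne_zero_iff.mpr fun j _ => ?_
  rw [sub_ne_zero]
  intro h'
  refine h.mul_bar_inv_ne_one v i (j + c) ?_
  rw [zpow_add₀ h.q_ne, zpow_natCast, h']
  ring

end GenericTriple

/-- The value at `x` of the interpolation polynomial of `v`, divided by its value at `a τ`. -/
def normEval (t a : k) {n : ℕ} (g : (Fin n → ℤ) → MvPolynomial (Fin n) k) (v : Fin n → ℤ)
    (x : Fin n → k) : k :=
  eval x (g v) / eval (fun i => a * tau t n i) (g v)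

theorem IsFamily.eval_zero {q t : k} {n : ℕ} {g : (Fin n → ℤ) → MvPolynomial (Fin n) k}
    (hg : IsFamily q t g) : ∃ c, c ≠ 0 ∧ ∀ x, eval x (g 0) = c := by
  have h1 := hg.degree_le 0 le_rfl
  have h2 := hg.ne_zero 0 le_rfl
  simp only [Pi.zero_apply, Finset.sum_const_zero] at h1
  have h3 : (g 0).totalDegree = 0 := by omega
  rw [totalDegree_eq_zero_iff_eq_C] at h3
  refine ⟨coeff 0 (g 0), fun h0 => h2 (by rw [h3, h0, C_0]), fun x => ?_⟩
  rw [h3]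
  simp

theorem tau_last (n : ℕ) (t : k) : tau t (n + 1) (Fin.last n) = t ^ (-(n : ℤ)) := by
  simp [tau]

theorem prod_bar_comp_swap {M : Type*} [CommMonoid M] {q t : k} (φ : k → M) {n : ℕ} {i j : Fin n}
    (hij : (j : ℕ) = i + 1) (v : Fin n → ℤ) :
    ∏ l, φ (bar q t (v ∘ Equiv.swap i j) l) = ∏ l, φ (bar q t v l) := by
  by_cases hv : v i = v j
  · rw [comp_swap_of_eq hv]
  · rw [bar_comp_swap q t hij hv, ← Equiv.prod_comp (Equiv.swap i j) fun l => φ (bar q t v l)]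
    rfl

theorem prod_bar_rot {M : Type*} [CommMonoid M] {q t : k} (φ : k → M) (hq : q ≠ 0) {n : ℕ}
    (v : Fin (n + 1) → ℤ) : ∏ l, φ (bar q t (rot v) l) =
      φ (q * bar q t v 0) * ∏ l : Fin n, φ (bar q t v l.succ) := by
  rw [Fin.prod_univ_castSucc, bar_rot_last t hq, mul_comm]
  simp only [bar_rot_castSucc]

theorem normEval_zero {q t a : k} {n : ℕ} {g : (Fin n → ℤ) → MvPolynomial (Fin n) k}
    (hg : IsFamily q t g) (x : Fin n → k) : normEval t a g 0 x = 1 := by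
  obtain ⟨c, hc, hx⟩ := hg.eval_zero
  rw [normEval, hx, hx, div_self hc]

variable [Infinite k] {q t a : k} (h : GenericTriple q t a)

section Cyclic

variable {n : ℕ} {g : (Fin (n + 1) → ℤ) → MvPolynomial (Fin (n + 1)) k} (hg : IsFamily q t g)

/-- The same unknown c occurs at a general x and at aτ; comparing the two eliminates it from the
normalised functions. -/
theorem eval_tau_swap_rel {n : ℕ} {g : (Fin n → ℤ) → MvPolynomial (Fin n) k}
    (hg : IsFamily q t g) (h : GenericTriple q t a) {v : Fin n → ℤ} (hv : 0 ≤ v) {i j : Fin n}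
    (hij : (j : ℕ) = i + 1) : ∃ c, (∀ x, (bar q t v i - bar q t v j) * eval x (hecke t i j (g v)) =
      (t - 1) * bar q t v i * eval x (g v) + c * eval x (g (v ∘ Equiv.swap i j))) ∧
      (bar q t v i - t * bar q t v j) * eval (fun i => a * tau t n i) (g v) =
        c * eval (fun i => a * tau t n i) (g (v ∘ Equiv.swap i j)) := by
  obtain ⟨c, hc⟩ := hg.exists_hecke_eq h.toGeneric h.t_ne_one hv hij
  have h0 := h.toGeneric.bar_sub_ne_zero h.t_ne_one v hij
  have hx : ∀ x, (bar q t v i - bar q t v j) * eval x (hecke t i j (g v)) =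
      (t - 1) * bar q t v i * eval x (g v) +
        (bar q t v i - bar q t v j) * c * eval x (g (v ∘ Equiv.swap i j)) := by
    intro x
    rw [hc, map_add, map_mul, map_mul, eval_C, eval_C]
    field_simp
  refine ⟨(bar q t v i - bar q t v j) * c, hx, ?_⟩
  have h1 := hx fun i => a * tau t n i
  rw [eval_hecke_of_eq_mul h.t_ne_one] at h1
  · linear_combination h1
  · rw [tau_of_adj h.t_ne hij]
    ring
  · exact mul_ne_zero h.a_ne (tau_ne_zero h.t_ne _)

include h hg in
-- Raising at aτ involves the value of g v at `unrot` of aτ, which `IsFamily.eval_unrot_tau`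
-- expresses through the value at aτ itself.
theorem IsFamily.raise_tau {v : Fin (n + 1) → ℤ} (hv : 0 ≤ v) :
    ∃ c, (∀ x, (t ^ (n : ℤ) * x (Fin.last n) - 1) * eval (unrot q x) (g v) =
      c * eval x (g (rot v))) ∧ (a * (bar q t v 0)⁻¹ - 1) * eval (fun i => a * tau t (n + 1) i)
        (g v) = c * eval (fun i => a * tau t (n + 1) i) (g (rot v)) := by
  obtain ⟨c, hc⟩ := hg.exists_raise_eq h.toGeneric hv
  have h1 : t ^ (n : ℤ) * t ^ (-(n : ℤ)) = 1 := by
    rw [← zpow_add₀ h.t_ne]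
    simp
  have hx : ∀ x, (t ^ (n : ℤ) * x (Fin.last n) - 1) * eval (unrot q x) (g v) =
      t ^ (n : ℤ) * c * eval x (g (rot v)) := by
    intro x
    have h2 := congrArg (eval x) hc
    rw [eval_raise, map_mul, eval_C] at h2
    linear_combination t ^ (n : ℤ) * h2 + eval (unrot q x) (g v) * h1
  refine ⟨_, hx, ?_⟩
  rw [← hx, ← hg.eval_unrot_tau h.toGeneric h.t_ne_one hv h.a_ne, tau_last]
  linear_combination -a * eval (unrot q fun i => a * tau t (n + 1) i) (g v) * h1

end Cyclic

variable {n : ℕ} {g : (Fin n → ℤ) → MvPolynomial (Fin n) k} (hg : IsFamily q t g)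

include h hg in
-- Along `comp_induction` the value changes by factors v̄_i - t v̄_j with v_i ≠ v_j, or a v̄_1⁻¹ -
-- 1, none of which is zero.
theorem IsFamily.eval_tau_ne_zero {v : Fin n → ℤ} (hv : 0 ≤ v) :
    eval (fun i => a * tau t n i) (g v) ≠ 0 := by
  have zero : eval (fun i => a * tau t n i) (g 0) ≠ 0 := by
    obtain ⟨c, hc, hx⟩ := hg.eval_zero
    rwa [hx]
  cases n with
  | zero => rwa [Subsingleton.elim v 0]
  | succ n =>
    refine comp_induction (P := fun v => eval (fun i => a * tau t (n + 1) i) (g v) ≠ 0) zero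
      (fun v hv i j hij hP => ?_) (fun v hv hP => ?_) hv
    · by_cases hvij : v i = v j
      · rwa [comp_swap_of_eq hvij]
      · obtain ⟨c, -, hc⟩ := eval_tau_swap_rel hg h hv hij
        have h1 : bar q t v i - t * bar q t v j ≠ 0 := by
          have := h.bar_ne_of_ne hvij 1
          rwa [zpow_one, ← sub_ne_zero] at this
        exact right_ne_zero_of_mul (hc ▸ mul_ne_zero h1 hP)
    · obtain ⟨c, -, hc⟩ := hg.raise_tau h hv
      exact right_ne_zero_of_mul (hc ▸ mul_ne_zero (h.mul_bar_inv_ne_one' v 0) hP)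

include h hg in
theorem normEval_hecke {v : Fin n → ℤ} (hv : 0 ≤ v) {i j : Fin n} (hij : (j : ℕ) = i + 1)
    (x : Fin n → k) :
    (x i - x j) * ((t - 1) * bar q t v i * normEval t a g v x +
      (bar q t v i - t * bar q t v j) * normEval t a g (v ∘ Equiv.swap i j) x) =
    (bar q t v i - bar q t v j) * ((t - 1) * x i * normEval t a g v x +
      (x i - t * x j) * normEval t a g v (x ∘ Equiv.swap i j)) := by
  obtain ⟨c, hx, hc⟩ := eval_tau_swap_rel hg h hv hij
  have h1 := hg.eval_tau_ne_zero h hv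
  have h2 := hg.eval_tau_ne_zero h (comp_swap_nonneg hv i j)
  have h3 := hx x
  have h4 := eval_hecke t i j (g v) x
  simp only [normEval]
  set y := eval (fun i => a * tau t n i) (g v)
  set y' := eval (fun i => a * tau t n i) (g (v ∘ Equiv.swap i j))
  have h5 : (bar q t v i - t * bar q t v j) * (eval x (g (v ∘ Equiv.swap i j)) / y') =
      c * (eval x (g (v ∘ Equiv.swap i j)) / y) := by
    field_simp
    linear_combination eval x (g (v ∘ Equiv.swap i j)) * hc
  rw [h5]
  field_simp
  linear_combination (bar q t v i - bar q t v j) * h4 - (x i - x j) * h3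

include h hg in
-- At cũ the coordinates i, j are a common multiple of 1/ū_{j'}, 1/ū_{i'}. The relation is
-- homogeneous in x, so the multiple drops out and the coefficients take the same shape in u as in
-- v.
theorem normEval_hecke_tilde {v : Fin n → ℤ} (hv : 0 ≤ v) {i j i' j' : Fin n}
    (hij : (j : ℕ) = i + 1) (hi' : i' = j.rev) (hj' : j' = i.rev) (u : Fin n → ℤ) {c : k}
    (hc : c ≠ 0) :
    (bar q t u i' - bar q t u j') *
      ((t - 1) * bar q t v i * normEval t a g v (fun l => c * tilde q t u l) +
      (bar q t v i - t * bar q t v j) *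
        normEval t a g (v ∘ Equiv.swap i j) (fun l => c * tilde q t u l)) =
    (bar q t v i - bar q t v j) *
      ((t - 1) * bar q t u i' * normEval t a g v (fun l => c * tilde q t u l) +
      (bar q t u i' - t * bar q t u j') *
        normEval t a g v (fun l => c * tilde q t (u ∘ Equiv.swap i' j') l)) := by
  have hij' : (j' : ℕ) = i' + 1 := by
    rw [hi', hj', Fin.val_rev, Fin.val_rev]
    omega
  have h1 := normEval_hecke h hg hv hij fun l => c * tilde q t u l
  -- For equal entries of u the two points differ, but the coefficient vanishes.
  have h2 : (bar q t u i' - t * bar q t u j') *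
        normEval t a g v (fun l => c * tilde q t (u ∘ Equiv.swap i' j') l) =
      (bar q t u i' - t * bar q t u j') *
        normEval t a g v ((fun l => c * tilde q t u l) ∘ Equiv.swap i j) := by
    by_cases hu : u i' = u j'
    · rw [bar_of_eq q h.t_ne hij' hu, sub_self, zero_mul, zero_mul]
    · rw [tilde_comp_swap q hij' hu, hi', hj', Fin.rev_rev, Fin.rev_rev]
      rfl
  have h3 : tilde q t u i = t ^ (1 - (n : ℤ)) * (bar q t u j')⁻¹ := by
    rw [tilde_eq q h.t_ne, hj']
  have h4 : tilde q t u j = t ^ (1 - (n : ℤ)) * (bar q t u i')⁻¹ := by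
    rw [tilde_eq q h.t_ne, hi']
  rw [h2]
  beta_reduce at h1
  rw [h3, h4] at h1
  have n1 := bar_ne_zero h.q_ne h.t_ne u i'
  have n2 := bar_ne_zero h.q_ne h.t_ne u j'
  have n3 := zpow_ne_zero (1 - (n : ℤ)) h.t_ne
  generalize normEval t a g v (fun l => c * tilde q t u l) = A at *
  generalize normEval t a g (v ∘ Equiv.swap i j) (fun l => c * tilde q t u l) = B at *
  generalize normEval t a g v ((fun l => c * tilde q t u l) ∘ Equiv.swap i j) = E at *
  generalize t ^ (1 - (n : ℤ)) = T at *
  field_simp at h1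
  linear_combination h1

include h in
theorem normEval_rot {n : ℕ} {g : (Fin (n + 1) → ℤ) → MvPolynomial (Fin (n + 1)) k}
    (hg : IsFamily q t g) {v : Fin (n + 1) → ℤ} (hv : 0 ≤ v) (x : Fin (n + 1) → k) :
    (a * (bar q t v 0)⁻¹ - 1) * normEval t a g (rot v) x =
      (t ^ (n : ℤ) * x (Fin.last n) - 1) * normEval t a g v (unrot q x) := by
  obtain ⟨c, hx, hc⟩ := hg.raise_tau h hv
  have h1 := hg.eval_tau_ne_zero h hv
  have h2 := hg.eval_tau_ne_zero h (rot_nonneg hv)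
  have h3 := hx x
  simp only [normEval]
  rw [← mul_div_assoc, ← mul_div_assoc, h3, div_eq_div_iff h2 h1]
  linear_combination eval x (g (rot v)) * hc

include h hg in
/-- The evaluation formula for the values at multiples of `τ`. -/
theorem normEval_mul_tau {z : k} (hz : z ≠ 0) (φ : k → k)
    (hφ : ∀ (w : Fin n → ℤ) i, φ (q * bar q t w i) * (a * (bar q t w i)⁻¹ - 1) =
      φ (bar q t w i) * (z * (bar q t w i)⁻¹ - 1)) {v : Fin n → ℤ} (hv : 0 ≤ v) :
    normEval t a g v (fun i => z * tau t n i) * ∏ i, φ (tau t n i) =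
      ∏ i, φ (bar q t v i) := by
  have zero : normEval t a g 0 (fun i => z * tau t n i) * ∏ i, φ (tau t n i) =
      ∏ i, φ (bar q t (0 : Fin n → ℤ) i) := by
    rw [normEval_zero hg, one_mul, bar_zero]
  cases n with
  | zero => rwa [Subsingleton.elim v 0]
  | succ n =>
    refine comp_induction (P := fun v => normEval t a g v (fun i => z * tau t (n + 1) i) *
      ∏ i, φ (tau t (n + 1) i) = ∏ i, φ (bar q t v i)) zero
      (fun v hv i j hij hP => ?_) (fun v hv hP => ?_) hv
    · beta_reduce at hP ⊢
      rw [prod_bar_comp_swap φ hij, ← hP]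
      by_cases hvij : v i = v j
      · rw [comp_swap_of_eq hvij]
      · have h1 : bar q t v i - t * bar q t v j ≠ 0 := by
          have := h.bar_ne_of_ne hvij 1
          rwa [zpow_one, ← sub_ne_zero] at this
        -- At zτ the coefficient x_i - t x_j is zero, and the relation reduces to equality of the
        -- normalised values of v and its transpose.
        have h2 := normEval_hecke h hg hv hij fun i => z * tau t (n + 1) i
        rw [tau_of_adj h.t_ne hij] at h2
        have h3 : (t - 1) * (z * tau t (n + 1) j) ≠ 0 :=
          mul_ne_zero (sub_ne_zero.mpr h.t_ne_one) (mul_ne_zero hz (tau_ne_zero h.t_ne _))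
        congr 1
        apply mul_left_cancel₀ (mul_ne_zero h3 h1)
        linear_combination h2
    · beta_reduce at hP ⊢
      rw [Fin.prod_univ_succ (fun i => φ (bar q t v i))] at hP
      rw [prod_bar_rot φ h.q_ne]
      have h1 := normEval_rot h hg hv fun i => z * tau t (n + 1) i
      have h2 := hg.eval_unrot_tau h.toGeneric h.t_ne_one hv hz
      have h3 : (z - 1) * normEval t a g v (unrot q fun i => z * tau t (n + 1) i) =
          (z * (bar q t v 0)⁻¹ - 1) * normEval t a g v (fun i => z * tau t (n + 1) i) := by
        simp only [normEval]
        rw [← mul_div_assoc, ← mul_div_assoc, h2]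
      have h4 : t ^ (n : ℤ) * (z * tau t (n + 1) (Fin.last n)) = z := by
        rw [tau_last, mul_left_comm, ← zpow_add₀ h.t_ne]
        simp
      rw [h4, h3] at h1
      have h5 := hφ v 0
      apply mul_left_cancel₀ (h.mul_bar_inv_ne_one' v 0)
      linear_combination (∏ i, φ (tau t (n + 1) i)) * h1 + (z * (bar q t v 0)⁻¹ - 1) * hP -
        (∏ l : Fin n, φ (bar q t v l.succ)) * h5

end Norm

/-! ### Shifts and the duality -/

section Shift

variable {k : Type*} [Field k]

theorem eval_dilate (c : k) {n : ℕ} (f : MvPolynomial (Fin n) k) (x : Fin n → k) :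
    eval x (dilate c f) = eval (fun i => c * x i) f := by
  rw [dilate, eval_bind₁]
  simp

theorem totalDegree_dilate_le (c : k) {n : ℕ} (f : MvPolynomial (Fin n) k) :
    (dilate c f).totalDegree ≤ f.totalDegree := by
  refine totalDegree_bind₁_le (fun i => (totalDegree_mul _ _).trans ?_) f
  rw [totalDegree_C, totalDegree_X]

/-- The polynomial `∏_i (x_i - t ^ (1 - n)) f(x / q)`. -/
def raiseAll (q t : k) {n : ℕ} (f : MvPolynomial (Fin n) k) : MvPolynomial (Fin n) k :=
  (∏ i, (X i - C (t ^ (1 - (n : ℤ))))) * dilate q⁻¹ f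

theorem eval_raiseAll (q t : k) {n : ℕ} (f : MvPolynomial (Fin n) k) (x : Fin n → k) :
    eval x (raiseAll q t f) =
      (∏ i, (x i - t ^ (1 - (n : ℤ)))) * eval (fun i => q⁻¹ * x i) f := by
  rw [raiseAll, map_mul, eval_dilate, map_prod]
  simp

theorem totalDegree_raiseAll_le (q t : k) {n : ℕ} (f : MvPolynomial (Fin n) k) :
    (raiseAll q t f).totalDegree ≤ f.totalDegree + n := by
  refine (totalDegree_mul _ _).trans ?_
  rw [add_comm]
  refine add_le_add (totalDegree_dilate_le _ _) ((totalDegree_finsetProd _ _).trans ?_)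
  simp only [totalDegree_X_sub_C]
  simp

theorem eval_bar_raiseAll_eq_zero {q t : k} (hqt : Generic q t) {n : ℕ}
    {f : MvPolynomial (Fin n) k} {w : Fin n → ℤ} (hw : 0 ≤ w)
    (h : (∀ i, 1 ≤ w i) → eval (bar q t fun i => w i + -1) f = 0) :
    eval (bar q t w) (raiseAll q t f) = 0 := by
  rw [eval_raiseAll]
  by_cases h0 : ∃ i, w i = 0
  · obtain ⟨i, hi, hk⟩ := exists_kIndex_eq hw h0
    rw [Finset.prod_eq_zero (Finset.mem_univ i), zero_mul]
    have : (1 - (n : ℤ)) = -(kIndex w i : ℤ) := by omega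
    rw [this, bar, hi, zpow_zero, one_mul, sub_self]
  · push Not at h0
    have h1 := h fun i => by
      have := hw i
      have := h0 i
      simp only [Pi.zero_apply] at *
      omega
    rw [bar_add_const t hqt.q_ne] at h1
    simp only [zpow_neg, zpow_one] at h1
    rw [h1, mul_zero]

variable [Infinite k] {q t a : k}

theorem IsFamily.exists_raiseAll_eq (hqt : Generic q t) {n : ℕ}
    {g : (Fin n → ℤ) → MvPolynomial (Fin n) k} (hg : IsFamily q t g) {v : Fin n → ℤ}
    (hv : 0 ≤ v) : ∃ c, raiseAll q t (g v) = C c * g (fun i => v i + 1) := by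
  have hsum : ∀ w : Fin n → ℤ, ∀ c : ℤ, ∑ i, (w i + c) = ∑ i, w i + n * c := by
    intro w c
    simp [Finset.sum_add_distrib]
  have hv1 : 0 ≤ fun i => v i + 1 := fun i => add_nonneg (hv i) zero_le_one
  refine hg.exists_eq_C_mul hqt hv1 ?_ fun w hw hwd hwv => ?_
  · rw [hsum]
    have h1 := hg.degree_le v hv
    have h2 := totalDegree_raiseAll_le q t (g v)
    omega
  · refine eval_bar_raiseAll_eq_zero hqt hw fun h1 => ?_
    refine hg.vanish v _ hv (fun i => ?_) ?_ fun h2 => hwv ?_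
    · have := h1 i
      simp only [Pi.zero_apply]
      omega
    · rw [hsum] at hwd ⊢
      linarith
    · rw [← h2]
      funext i
      ring

variable (h : GenericTriple q t a) {n : ℕ} {g : (Fin n → ℤ) → MvPolynomial (Fin n) k}
  (hg : IsFamily q t g)

theorem prod_tau_rev {M : Type*} [CommMonoid M] {k : Type*} [Field k] {t : k} (ht : t ≠ 0) {n : ℕ}
    (φ : k → M) : ∏ i, φ (t ^ ((n : ℤ) - 1) * tau t n i) = ∏ i, φ (tau t n i)⁻¹ := by
  rw [← Equiv.prod_comp Fin.revPerm]
  refine Finset.prod_congr rfl fun i _ => ?_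
  congr 1
  rw [tau, tau, ← zpow_neg, ← zpow_add₀ ht, Fin.revPerm_apply, Fin.val_rev]
  congr 1
  omega

theorem prod_tilde {M : Type*} [CommMonoid M] {k : Type*} [Field k] {q t : k} (ht : t ≠ 0) {n : ℕ}
    (φ : k → M) (u : Fin n → ℤ) :
    ∏ i, φ (t ^ ((n : ℤ) - 1) * tilde q t u i) = ∏ i, φ (bar q t u i)⁻¹ := by
  rw [← Equiv.prod_comp Fin.revPerm]
  refine Finset.prod_congr rfl fun i _ => ?_
  rw [tilde_eq q ht, Fin.revPerm_apply, Fin.rev_rev, ← mul_assoc, ← zpow_add₀ ht]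
  simp

include h hg in
-- The proportionality constant of `raiseAll` is found by evaluating at aτ, which requires the value
-- of g v at q⁻¹aτ.
theorem normEval_add_one {v : Fin n → ℤ} (hv : 0 ≤ v) (x : Fin n → k) :
    (∏ i, (1 - a * (bar q t v i)⁻¹)) * normEval t a g (fun i => v i + 1) x =
      (∏ i, (1 - t ^ ((n : ℤ) - 1) * x i)) * normEval t a g v (fun i => q⁻¹ * x i) := by
  obtain ⟨c, hc⟩ := hg.exists_raiseAll_eq h.toGeneric hv
  have hv1 : 0 ≤ fun i => v i + 1 := fun i => add_nonneg (hv i) zero_le_one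
  have h1 := hg.eval_tau_ne_zero h hv
  have h2 := hg.eval_tau_ne_zero h hv1
  have hT : ∀ x : Fin n → k, ∏ i, (1 - t ^ ((n : ℤ) - 1) * x i) =
      (∏ _i : Fin n, -t ^ ((n : ℤ) - 1)) * ∏ i, (x i - t ^ (1 - (n : ℤ))) := by
    intro x
    rw [← Finset.prod_mul_distrib]
    refine Finset.prod_congr rfl fun i _ => ?_
    rw [mul_sub, neg_mul, neg_mul, ← zpow_add₀ h.t_ne]
    simp
    ring
  have hx : ∀ x, (∏ i, (1 - t ^ ((n : ℤ) - 1) * x i)) * eval (fun i => q⁻¹ * x i) (g v) =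
      (∏ _i : Fin n, -t ^ ((n : ℤ) - 1)) * c * eval x (g fun i => v i + 1) := by
    intro x
    have h3 := congrArg (eval x) hc
    rw [eval_raiseAll, map_mul, eval_C] at h3
    rw [hT]
    linear_combination (∏ _i : Fin n, -t ^ ((n : ℤ) - 1)) * h3
  -- For z = a/q the difference equation is solved by φ(y) = 1 - a/y.
  have h3 := normEval_mul_tau h hg (z := q⁻¹ * a) (mul_ne_zero (inv_ne_zero h.q_ne) h.a_ne)
    (fun y => 1 - a * y⁻¹) (fun w i => by
      rw [mul_inv]
      ring) hv
  have h4 := hx fun i => a * tau t n i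
  have h5 := prod_tau_rev h.t_ne (n := n) fun y => 1 - a * y
  have h6 : (∏ i, (1 - t ^ ((n : ℤ) - 1) * (a * tau t n i))) = ∏ i, (1 - a * (tau t n i)⁻¹) := by
    rw [← h5]
    refine Finset.prod_congr rfl fun i _ => ?_
    ring
  rw [h6] at h4
  have h7 := hx x
  rw [← h3]
  simp only [normEval, mul_assoc] at *
  generalize eval (fun i => q⁻¹ * (a * tau t n i)) (g v) = y1 at *
  generalize eval (fun i => q⁻¹ * x i) (g v) = y2 at *
  generalize eval (fun i => a * tau t n i) (g v) = y3 at *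
  generalize ∏ i, (1 - a * (tau t n i)⁻¹) = P at *
  field_simp
  linear_combination eval x (g fun i => v i + 1) * h4 -
    eval (fun i => a * tau t n i) (g fun i => v i + 1) * h7

theorem prod_qPoch_ne_zero {k : Type*} [Field k] {q t a : k} (h : GenericTriple q t a) {n : ℕ}
    (u : Fin n → ℤ) (c : ℤ) (m : ℕ) :
    ∏ i, qPoch q (q ^ c * a * (bar q t u i)⁻¹) m ≠ 0 :=
  Finset.prod_ne_zero_iff.mpr fun i _ => h.qPoch_ne_zero u i c m

/-- The value at `a ũ` of the normalised interpolation function of an integral vector `v`, computed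
with the shift by `m`. -/
def extEval (q t a : k) (g : (Fin n → ℤ) → MvPolynomial (Fin n) k) (m : ℕ) (v u : Fin n → ℤ) : k :=
  (∏ i, qPoch q (q ^ (1 - (m : ℤ)) * a * (bar q t v i)⁻¹) m) /
    (∏ i, qPoch q (q ^ (1 : ℤ) * a * (bar q t u i)⁻¹) m) *
    normEval t a g (fun i => v i + m) (fun i => q ^ (m : ℤ) * a * tilde q t u i)

omit [Infinite k] in
theorem extEval_zero_left (hg : IsFamily q t g) (u : Fin n → ℤ) : extEval q t a g 0 0 u = 1 := by
  have : (fun i => (0 : Fin n → ℤ) i + ((0 : ℕ) : ℤ)) = 0 := by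
    funext i
    simp
  rw [extEval, this, normEval_zero hg]
  simp [qPoch]

include h hg in
-- Since the tilde of 0 is τ, this is the product formula at z = q^m a with φ(y) = 1/(qa/y; q)_m;
-- the prefactors of `extEval` are its reciprocal.
theorem extEval_zero_right {m : ℕ} {v : Fin n → ℤ} (hv : 0 ≤ fun i => v i + (m : ℤ)) :
    extEval q t a g m v 0 = 1 := by
  have h1 := normEval_mul_tau h hg (z := q ^ (m : ℤ) * a)
    (mul_ne_zero (zpow_ne_zero _ h.q_ne) h.a_ne)
    (fun y => (qPoch q (q ^ (1 : ℤ) * a * y⁻¹) m)⁻¹) (fun w i => by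
      have h2 := h.qPoch_ne_zero w i 1 m
      have h3 := h.qPoch_ne_zero w i 0 m
      have h4 := one_sub_mul_qPoch q (a * (bar q t w i)⁻¹) m
      have h5 : q ^ (1 : ℤ) * a * (q * bar q t w i)⁻¹ = a * (bar q t w i)⁻¹ := by
        have := h.q_ne
        rw [zpow_one, mul_inv]
        field_simp
      rw [zpow_one, mul_assoc] at h2
      rw [zpow_zero, one_mul] at h3
      rw [h5, zpow_one, mul_assoc q a, zpow_natCast, inv_mul_eq_div, inv_mul_eq_div,
        div_eq_div_iff h3 h2]
      linear_combination -h4) hv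
  rw [bar_add_const t h.q_ne] at h1
  have h2 : ∀ i, q ^ (1 : ℤ) * a * (q ^ (m : ℤ) * bar q t v i)⁻¹ =
      q ^ (1 - (m : ℤ)) * a * (bar q t v i)⁻¹ := by
    intro i
    rw [mul_inv, zpow_sub₀ h.q_ne]
    ring
  simp only [h2, Finset.prod_inv_distrib] at h1
  have h3 := prod_qPoch_ne_zero h v (1 - (m : ℤ)) m
  have h4 := prod_qPoch_ne_zero h (0 : Fin n → ℤ) 1 m
  rw [bar_zero] at h4
  rw [extEval, tilde_zero, bar_zero, div_mul_eq_mul_div, mul_div_assoc, div_eq_mul_inv, h1,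
    mul_inv_cancel₀ h3]

omit [Infinite k] in
include h in
theorem prod_qPoch_succ {m : ℕ} (v : Fin n → ℤ) :
    ∏ i, qPoch q (q ^ (1 - ((m + 1 : ℕ) : ℤ)) * a * (bar q t v i)⁻¹) (m + 1) =
      (∏ i, (1 - a * (q ^ (m : ℤ) * bar q t v i)⁻¹)) *
        ∏ i, qPoch q (q ^ (1 - (m : ℤ)) * a * (bar q t v i)⁻¹) m := by
  rw [← Finset.prod_mul_distrib]
  refine Finset.prod_congr rfl fun i _ => ?_
  have := h.q_ne
  have e3 : q ^ (1 - ((m + 1 : ℕ) : ℤ)) * a * (bar q t v i)⁻¹ =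
      a * (q ^ (m : ℤ) * bar q t v i)⁻¹ := by
    rw [mul_inv, ← zpow_neg]
    have : (1 - ((m + 1 : ℕ) : ℤ)) = -(m : ℤ) := by
      push_cast
      ring
    rw [this]
    ring
  have e4 : q * (a * (q ^ (m : ℤ) * bar q t v i)⁻¹) =
      q ^ (1 - (m : ℤ)) * a * (bar q t v i)⁻¹ := by
    rw [mul_inv, zpow_sub₀ h.q_ne, zpow_one]
    ring
  rw [qPoch_succ', e3, e4]

include h hg in
theorem normEval_shift_succ {m : ℕ} {v : Fin n → ℤ} (hv : 0 ≤ fun i => v i + (m : ℤ))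
    (x : Fin n → k) :
    (∏ i, qPoch q (q ^ (1 - ((m + 1 : ℕ) : ℤ)) * a * (bar q t v i)⁻¹) (m + 1)) *
      normEval t a g (fun i => v i + ((m + 1 : ℕ) : ℤ)) (fun i => q ^ (m + 1) * x i) *
      ∏ i, qPoch q (q * (t ^ ((n : ℤ) - 1) * x i)) m =
    (∏ i, qPoch q (q ^ (1 - (m : ℤ)) * a * (bar q t v i)⁻¹) m) *
      normEval t a g (fun i => v i + (m : ℤ)) (fun i => q ^ m * x i) *
      ∏ i, qPoch q (q * (t ^ ((n : ℤ) - 1) * x i)) (m + 1) := by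
  have h1 := normEval_add_one h hg hv fun i => q ^ (m + 1) * x i
  rw [bar_add_const t h.q_ne] at h1
  have e1 : (fun i => v i + (m : ℤ) + 1) = fun i => v i + ((m + 1 : ℕ) : ℤ) := by
    funext i
    push_cast
    ring
  have e2 : (fun i => q⁻¹ * (q ^ (m + 1) * x i)) = fun i => q ^ m * x i := by
    funext i
    have := h.q_ne
    field_simp
    ring
  rw [e1, e2] at h1
  have hD : ∏ i, qPoch q (q * (t ^ ((n : ℤ) - 1) * x i)) (m + 1) =
      (∏ i, qPoch q (q * (t ^ ((n : ℤ) - 1) * x i)) m) *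
        ∏ i, (1 - t ^ ((n : ℤ) - 1) * (q ^ (m + 1) * x i)) := by
    rw [← Finset.prod_mul_distrib]
    refine Finset.prod_congr rfl fun i _ => ?_
    rw [qPoch_succ]
    ring
  rw [hD, prod_qPoch_succ h]
  linear_combination (∏ i, qPoch q (q ^ (1 - (m : ℤ)) * a * (bar q t v i)⁻¹) m) *
    (∏ i, qPoch q (q * (t ^ ((n : ℤ) - 1) * x i)) m) * h1

omit [Infinite k] in
include h in
theorem prod_qPoch_tilde (u : Fin n → ℤ) (m : ℕ) :
    ∏ i, qPoch q (q * (t ^ ((n : ℤ) - 1) * (a * tilde q t u i))) m =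
      ∏ i, qPoch q (q ^ (1 : ℤ) * a * (bar q t u i)⁻¹) m := by
  rw [← prod_tilde h.t_ne (fun y => qPoch q (q ^ (1 : ℤ) * a * y) m)]
  refine Finset.prod_congr rfl fun i _ => ?_
  congr 1
  rw [zpow_one]
  ring

include h hg in
theorem extEval_succ {m : ℕ} {v : Fin n → ℤ} (hv : 0 ≤ fun i => v i + (m : ℤ)) (u : Fin n → ℤ) :
    extEval q t a g (m + 1) v u = extEval q t a g m v u := by
  have h1 := normEval_shift_succ h hg hv fun i => a * tilde q t u i
  rw [prod_qPoch_tilde h, prod_qPoch_tilde h] at h1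
  rw [extEval, extEval, div_mul_eq_mul_div, div_mul_eq_mul_div,
    div_eq_div_iff (prod_qPoch_ne_zero h u 1 _) (prod_qPoch_ne_zero h u 1 _)]
  simpa only [zpow_natCast, mul_assoc] using h1

omit [Infinite k] in
include h in
-- Both sides involve the same normalised value: v + (m + 1) = (v + 1) + m, and the factor q in
-- q^(m+1) aũ is absorbed by lowering u. Only the Pochhammer prefactors differ.
theorem extEval_succ_eq (m : ℕ) (v u : Fin n → ℤ) :
    (∏ i, (1 - q * a * (bar q t u i)⁻¹)) * extEval q t a g (m + 1) v u =
      (∏ i, (1 - a * (bar q t v i)⁻¹)) *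
        extEval q t a g m (fun i => v i + 1) (fun i => u i + -1) := by
  have e1 : (fun i => v i + ((m + 1 : ℕ) : ℤ)) = fun i => v i + 1 + (m : ℤ) := by
    funext i
    push_cast
    ring
  have e2 : (fun i => q ^ ((m + 1 : ℕ) : ℤ) * a * tilde q t u i) =
      fun i => q ^ (m : ℤ) * a * tilde q t (fun i => u i + -1) i := by
    funext i
    rw [tilde_add_const t h.q_ne, neg_neg, Nat.cast_succ, zpow_add₀ h.q_ne]
    ring
  have hN : ∏ i, qPoch q (q ^ (1 - ((m + 1 : ℕ) : ℤ)) * a * (bar q t v i)⁻¹) (m + 1) =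
      (∏ i, qPoch q (q ^ (1 - (m : ℤ)) * a * (bar q t (fun i => v i + 1) i)⁻¹) m) *
        ∏ i, (1 - a * (bar q t v i)⁻¹) := by
    rw [← Finset.prod_mul_distrib]
    refine Finset.prod_congr rfl fun i _ => ?_
    have e3 : q ^ (1 - ((m + 1 : ℕ) : ℤ)) = q ^ (-(m : ℤ)) := by
      congr 1
      push_cast
      ring
    rw [qPoch_succ, bar_add_const t h.q_ne, e3]
    congr 2
    · rw [mul_inv, zpow_sub₀ h.q_ne, zpow_neg]
      have := h.q_ne
      field_simp
    · rw [zpow_neg, zpow_natCast]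
      have := h.q_ne
      field_simp
  have hD : ∏ i, qPoch q (q ^ (1 : ℤ) * a * (bar q t u i)⁻¹) (m + 1) =
      (∏ i, (1 - q * a * (bar q t u i)⁻¹)) *
        ∏ i, qPoch q (q ^ (1 : ℤ) * a * (bar q t (fun i => u i + -1) i)⁻¹) m := by
    rw [← Finset.prod_mul_distrib]
    refine Finset.prod_congr rfl fun i _ => ?_
    rw [qPoch_succ', bar_add_const t h.q_ne, mul_inv, zpow_neg, inv_inv, zpow_one]
    congr 2
    ring
  have h2 := prod_qPoch_ne_zero h (fun i => u i + -1) 1 m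
  have h3 : ∏ i, (1 - q * a * (bar q t u i)⁻¹) ≠ 0 :=
    Finset.prod_ne_zero_iff.mpr fun i _ => by
      rw [sub_ne_zero]
      have := h.mul_bar_inv_ne_one u i 1
      rw [zpow_one] at this
      exact this.symm
  rw [extEval, extEval, hN, hD, e1, e2]
  generalize ∏ i, (1 - q * a * (bar q t u i)⁻¹) = A at *
  generalize ∏ i, (1 - a * (bar q t v i)⁻¹) = B at *
  generalize ∏ i, qPoch q (q ^ (1 : ℤ) * a * (bar q t (fun i => u i + -1) i)⁻¹) m = D at *
  field_simp

include h hg in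
-- The prefactors are symmetric products over spectral vectors, unchanged by transpositions, so the
-- relation is inherited from `normEval_hecke_tilde`.
theorem extEval_hecke {m : ℕ} {v : Fin n → ℤ} (hv : 0 ≤ fun i => v i + (m : ℤ)) {i j i' j' : Fin n}
    (hij : (j : ℕ) = i + 1) (hi' : i' = j.rev) (hj' : j' = i.rev) (u : Fin n → ℤ) :
    (bar q t u i' - bar q t u j') *
      ((t - 1) * bar q t v i * extEval q t a g m v u +
      (bar q t v i - t * bar q t v j) * extEval q t a g m (v ∘ Equiv.swap i j) u) =
    (bar q t v i - bar q t v j) *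
      ((t - 1) * bar q t u i' * extEval q t a g m v u +
      (bar q t u i' - t * bar q t u j') * extEval q t a g m v (u ∘ Equiv.swap i' j')) := by
  have hij' : (j' : ℕ) = i' + 1 := by
    rw [hi', hj', Fin.val_rev, Fin.val_rev]
    omega
  have h1 := normEval_hecke_tilde h hg hv hij hi' hj' u
    (mul_ne_zero (zpow_ne_zero (m : ℤ) h.q_ne) h.a_ne)
  rw [bar_add_const t h.q_ne] at h1
  have h2 := zpow_ne_zero (m : ℤ) h.q_ne
  have e1 : (fun l => v l + (m : ℤ)) ∘ Equiv.swap i j =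
      fun l => (v ∘ Equiv.swap i j) l + (m : ℤ) := rfl
  rw [e1] at h1
  simp only [extEval, prod_bar_comp_swap (fun y => qPoch q (q ^ (1 - (m : ℤ)) * a * y⁻¹) m) hij,
    prod_bar_comp_swap (fun y => qPoch q (q ^ (1 : ℤ) * a * y⁻¹) m) hij']
  apply mul_left_cancel₀ h2
  linear_combination (∏ i, qPoch q (q ^ (1 - (m : ℤ)) * a * (bar q t v i)⁻¹) m) /
    (∏ i, qPoch q (q ^ (1 : ℤ) * a * (bar q t u i)⁻¹) m) * h1

include h in
-- Raising v or u alters only one factor in the corresponding prefactor, and `one_sub_mul_qPoch`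
-- converts that change into the linear factors shown.
theorem extEval_rot {n : ℕ} {g : (Fin (n + 1) → ℤ) → MvPolynomial (Fin (n + 1)) k}
    (hg : IsFamily q t g) {m : ℕ} {v : Fin (n + 1) → ℤ} (hv : 0 ≤ fun i => v i + (m : ℤ))
    (u : Fin (n + 1) → ℤ) :
    (a * (bar q t v 0)⁻¹ - 1) * extEval q t a g m (rot v) u =
      (a * (bar q t u 0)⁻¹ - 1) * extEval q t a g m v (rot u) := by
  have h1 := normEval_rot h hg hv fun i => q ^ (m : ℤ) * a * tilde q t u i
  have e1 : rot (fun i => v i + (m : ℤ)) = fun i => rot v i + (m : ℤ) := by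
    funext i
    refine Fin.lastCases ?_ (fun i => ?_) i
    · simp
      ring
    · simp
  have e2 : t ^ (n : ℤ) * (q ^ (m : ℤ) * a * tilde q t u (Fin.last n)) =
      q ^ (m : ℤ) * a * (bar q t u 0)⁻¹ := by
    rw [tilde_eq q h.t_ne, Fin.rev_last]
    have : t ^ (n : ℤ) * t ^ (1 - ((n + 1 : ℕ) : ℤ)) = 1 := by
      rw [← zpow_add₀ h.t_ne]
      simp
    linear_combination q ^ (m : ℤ) * a * (bar q t u 0)⁻¹ * this
  rw [unrot_smul, unrot_tilde t h.q_ne, e1, e2, bar_add_const t h.q_ne] at h1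
  have hv0 := bar_ne_zero h.q_ne h.t_ne v 0
  have hN := one_sub_mul_qPoch q (q ^ (-(m : ℤ)) * a * (bar q t v 0)⁻¹) m
  have hD := one_sub_mul_qPoch q (a * (bar q t u 0)⁻¹) m
  have e3 : q * (q ^ (-(m : ℤ)) * a * (bar q t v 0)⁻¹) =
      q ^ (1 - (m : ℤ)) * a * (bar q t v 0)⁻¹ := by
    rw [sub_eq_add_neg, zpow_add₀ h.q_ne, zpow_one]
    ring
  have e4 : q ^ (1 - (m : ℤ)) * a * (q * bar q t v 0)⁻¹ =
      q ^ (-(m : ℤ)) * a * (bar q t v 0)⁻¹ := by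
    have := h.q_ne
    rw [sub_eq_add_neg, zpow_add₀ h.q_ne, zpow_one, mul_inv]
    field_simp
  have e5 : q ^ (1 : ℤ) * a * (q * bar q t u 0)⁻¹ = a * (bar q t u 0)⁻¹ := by
    have := h.q_ne
    rw [zpow_one, mul_inv]
    field_simp
  have e6 : q ^ m * (q ^ (-(m : ℤ)) * a * (bar q t v 0)⁻¹) = a * (bar q t v 0)⁻¹ := by
    have := h.q_ne
    rw [zpow_neg, zpow_natCast]
    field_simp
  have e7 : a * (q ^ (m : ℤ) * bar q t v 0)⁻¹ = q ^ (-(m : ℤ)) * a * (bar q t v 0)⁻¹ := by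
    rw [mul_inv, zpow_neg]
    ring
  have e8 : q * (a * (bar q t u 0)⁻¹) = q ^ (1 : ℤ) * a * (bar q t u 0)⁻¹ := by
    rw [zpow_one, mul_assoc]
  rw [e3, e6] at hN
  rw [e8, ← mul_assoc, ← zpow_natCast] at hD
  rw [e7] at h1
  rw [extEval, extEval, prod_bar_rot (fun y => qPoch q (q ^ (1 - (m : ℤ)) * a * y⁻¹) m) h.q_ne,
    prod_bar_rot (fun y => qPoch q (q ^ (1 : ℤ) * a * y⁻¹) m) h.q_ne,
    Fin.prod_univ_succ (fun i => qPoch q (q ^ (1 - (m : ℤ)) * a * (bar q t v i)⁻¹) m),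
    Fin.prod_univ_succ (fun i => qPoch q (q ^ (1 : ℤ) * a * (bar q t u i)⁻¹) m), e4, e5]
  have n1 := h.qPoch_ne_zero u 0 1 m
  have n2 := h.qPoch_ne_zero u 0 0 m
  rw [zpow_zero, one_mul] at n2
  have n3 : ∏ i : Fin n, qPoch q (q ^ (1 : ℤ) * a * (bar q t u i.succ)⁻¹) m ≠ 0 :=
    Finset.prod_ne_zero_iff.mpr fun i _ => h.qPoch_ne_zero u i.succ 1 m
  generalize normEval t a g (fun i => rot v i + (m : ℤ))
    (fun i => q ^ (m : ℤ) * a * tilde q t u i) = A at *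
  generalize normEval t a g (fun i => v i + (m : ℤ))
    (fun i => q ^ (m : ℤ) * a * tilde q t (rot u) i) = B at *
  generalize ∏ i : Fin n, qPoch q (q ^ (1 : ℤ) * a * (bar q t u i.succ)⁻¹) m = P at *
  generalize ∏ i : Fin n, qPoch q (q ^ (1 - (m : ℤ)) * a * (bar q t v i.succ)⁻¹) m = R at *
  generalize qPoch q (q ^ (1 : ℤ) * a * (bar q t u 0)⁻¹) m = Y1 at *
  generalize qPoch q (a * (bar q t u 0)⁻¹) m = Y2 at *
  generalize qPoch q (q ^ (1 - (m : ℤ)) * a * (bar q t v 0)⁻¹) m = Z1 at *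
  generalize qPoch q (q ^ (-(m : ℤ)) * a * (bar q t v 0)⁻¹) m = Z2 at *
  generalize q ^ (-(m : ℤ)) * a * (bar q t v 0)⁻¹ = y at *
  generalize q ^ (m : ℤ) * a * (bar q t u 0)⁻¹ = z at *
  generalize a * (bar q t v 0)⁻¹ = y' at *
  generalize a * (bar q t u 0)⁻¹ = z' at *
  rw [div_mul_eq_mul_div, div_mul_eq_mul_div, ← mul_div_assoc, ← mul_div_assoc,
    div_eq_div_iff (mul_ne_zero n1 n3) (mul_ne_zero n2 n3)]
  linear_combination R * P * (A * Y2 * hN + Y2 * Z1 * h1 + Z1 * B * hD)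

end Shift

/-! ### Symmetry from the recurrences -/

section Symmetry

variable {k : Type*} [Field k] {q t a : k} (h : GenericTriple q t a)

include h in
/-- A function of two integral vectors with these recurrences is symmetric. -/
theorem symm_of_recurrences {n : ℕ} {F : (Fin n → ℤ) → (Fin n → ℤ) → k}
    (zero_left : ∀ u, F 0 u = 1) (zero_right : ∀ v, F v 0 = 1)
    (hecke : ∀ v u (i j i' j' : Fin n), (j : ℕ) = i + 1 → i' = j.rev → j' = i.rev →
      (bar q t u i' - bar q t u j') *
        ((t - 1) * bar q t v i * F v u +
        (bar q t v i - t * bar q t v j) * F (v ∘ Equiv.swap i j) u) =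
      (bar q t v i - bar q t v j) *
        ((t - 1) * bar q t u i' * F v u +
        (bar q t u i' - t * bar q t u j') * F v (u ∘ Equiv.swap i' j')))
    (rotate : ∀ (l : ℕ) (hl : n = l + 1) (v u : Fin (l + 1) → ℤ),
      (a * (bar q t v 0)⁻¹ - 1) * F (rot v ∘ Fin.cast hl) (u ∘ Fin.cast hl) =
        (a * (bar q t u 0)⁻¹ - 1) * F (v ∘ Fin.cast hl) (rot u ∘ Fin.cast hl))
    (shift : ∀ v u, (∏ i, (1 - q * a * (bar q t u i)⁻¹)) * F v u =
      (∏ i, (1 - a * (bar q t v i)⁻¹)) * F (fun i => v i + 1) (fun i => u i + -1))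
    (v u : Fin n → ℤ) : F v u = F u v := by
  have nonneg : ∀ v, 0 ≤ v → ∀ u, F v u = F u v := by
    have zero : ∀ u, F 0 u = F u 0 := fun u => by rw [zero_left, zero_right]
    intro v hv
    cases n with
    | zero =>
      rwa [Subsingleton.elim v 0]
    | succ n =>
      refine comp_induction (P := fun v => ∀ u, F v u = F u v) zero
        (fun v hv i j hij hP u => ?_) (fun v hv hP u => ?_) hv
      · by_cases hvij : v i = v j
        · rw [comp_swap_of_eq hvij, hP]
        · have hij' : ((i.rev : Fin (n + 1)) : ℕ) = j.rev + 1 := by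
            rw [Fin.val_rev, Fin.val_rev]
            omega
          -- The relation is used for (v, u) and for (u, v); the induction hypothesis identifies all
          -- terms except the two to be compared.
          have h1 := hecke v u i j _ _ hij rfl rfl
          have h2 := hecke u v j.rev i.rev i j hij' (Fin.rev_rev i).symm (Fin.rev_rev j).symm
          rw [hP, hP] at h1
          have h3 : bar q t v i - t * bar q t v j ≠ 0 := by
            have := h.bar_ne_of_ne hvij 1
            rwa [zpow_one, ← sub_ne_zero] at this
          have h4 := h.toGeneric.bar_sub_ne_zero h.t_ne_one u hij'
          apply mul_left_cancel₀ (mul_ne_zero h4 h3)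
          linear_combination h1 + h2
      · have h1 := rotate n rfl v u
        have h2 := rotate n rfl u v
        simp only [Fin.cast_refl, Function.comp_id] at h1 h2
        rw [hP] at h1
        apply mul_left_cancel₀ (h.mul_bar_inv_ne_one' v 0)
        linear_combination h1 + h2
  obtain ⟨m, hm⟩ : ∃ m : ℕ, 0 ≤ fun i => v i + (m : ℤ) := by
    refine ⟨minShift v, fun i => ?_⟩
    have : (-v i).toNat ≤ minShift v := Finset.le_sup (f := fun i => (-v i).toNat)
      (Finset.mem_univ i)
    simp only [Pi.zero_apply]
    omega
  -- Induction on a shift making v nonnegative: `shift` at (v, u) and at (u - 1, v + 1) involves the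
  -- same two products, on opposite sides.
  induction m generalizing v u with
  | zero => exact nonneg v (fun i => by simpa using hm i) u
  | succ m ih =>
    have h1 := shift v u
    have h2 := shift (fun i => u i + -1) (fun i => v i + 1)
    have e1 : (fun i => u i + -1 + 1) = u := by
      funext i
      ring
    have e2 : (fun i => v i + 1 + -1) = v := by
      funext i
      ring
    rw [e1, e2, bar_add_const t h.q_ne, bar_add_const t h.q_ne] at h2
    have e3 : ∀ i, 1 - q * a * (q ^ (1 : ℤ) * bar q t v i)⁻¹ = 1 - a * (bar q t v i)⁻¹ := by
      intro i
      have := h.q_ne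
      rw [zpow_one, mul_inv]
      field_simp
    have e4 : ∀ i, 1 - a * (q ^ (-1 : ℤ) * bar q t u i)⁻¹ = 1 - q * a * (bar q t u i)⁻¹ := by
      intro i
      rw [mul_inv, zpow_neg, inv_inv, zpow_one]
      ring
    simp only [e3, e4] at h2
    rw [ih (fun i => v i + 1) (fun i => u i + -1) (fun i => by
      have := hm i
      simp only [Pi.zero_apply] at *
      push_cast at this
      linarith)] at h1
    have h3 : ∏ i, (1 - q * a * (bar q t u i)⁻¹) ≠ 0 :=
      Finset.prod_ne_zero_iff.mpr fun i _ => by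
        rw [sub_ne_zero]
        have := h.mul_bar_inv_ne_one u i 1
        rw [zpow_one] at this
        exact this.symm
    apply mul_left_cancel₀ h3
    linear_combination h1 + h2

end Symmetry

/-! ### Shifts of the interpolation polynomials -/

section ShiftG

theorem coeff_dilate {k : Type*} [Field k] (c : k) {n : ℕ} (f : MvPolynomial (Fin n) k)
    (s : Fin n →₀ ℕ) : coeff s (dilate c f) = c ^ (∑ i, s i) * coeff s f := by
  classical
  induction f using MvPolynomial.induction_on generalizing s with
  | C a =>
    rw [dilate, bind₁_C_right, coeff_C]
    split_ifs with h
    · simp [← h]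
    · simp
  | add p r hp hr =>
    have : dilate c (p + r) = dilate c p + dilate c r := map_add _ _ _
    rw [this, coeff_add, coeff_add, hp, hr]
    ring
  | mul_X p i hp =>
    have : dilate c (p * X i) = C c * (dilate c p * X i) := by
      rw [dilate, map_mul, bind₁_X_right, dilate]
      ring
    rw [this, coeff_C_mul, coeff_mul_X', coeff_mul_X']
    split_ifs with h
    · obtain ⟨r, rfl⟩ : ∃ r, s = r + Finsupp.single i 1 :=
        ⟨s - Finsupp.single i 1, (tsub_add_cancel_of_le (Finsupp.single_le_iff.mpr
          (Nat.one_le_iff_ne_zero.mpr (Finsupp.mem_support_iff.mp h)))).symm⟩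
      have h1 : ∑ l, (r + Finsupp.single i 1 : Fin n →₀ ℕ) l = ∑ l, r l + 1 := by
        simp [Finset.sum_add_distrib, Finsupp.single_apply]
      rw [add_tsub_cancel_right, hp, h1]
      ring
    · simp

/-- The constant c never contributes: its terms have degree too small to reach the monomial in
question. -/
theorem coeff_prod_X_sub_C_mul {k : Type*} [Field k] {n : ℕ} (c : k) (S : Finset (Fin n))
    {s : Fin n →₀ ℕ} {f : MvPolynomial (Fin n) k} (hf : f.totalDegree ≤ ∑ i, s i) :
    coeff (s + ∑ i ∈ S, Finsupp.single i 1) ((∏ i ∈ S, (X i - C c)) * f) = coeff s f := by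
  classical
  induction S using Finset.induction_on with
  | empty => simp
  | insert i S hi ih =>
    rw [Finset.prod_insert hi, Finset.sum_insert hi, mul_assoc, sub_mul, coeff_sub, coeff_C_mul]
    have h1 : s + (Finsupp.single i 1 + ∑ i ∈ S, Finsupp.single i 1) =
        (s + ∑ i ∈ S, Finsupp.single i 1) + Finsupp.single i 1 := by
      rw [add_comm (Finsupp.single i 1), add_assoc]
    have h2 : ((∏ i ∈ S, (X i - C c)) * f).totalDegree ≤ S.card + ∑ i, s i := by
      refine (totalDegree_mul _ _).trans (add_le_add ((totalDegree_finsetProd _ _).trans ?_) hf)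
      simp only [totalDegree_X_sub_C]
      simp
    have h3 : ∀ r : Fin n →₀ ℕ, ∑ i ∈ r.support, r i = ∑ i, r i := fun r =>
      Finset.sum_subset (Finset.subset_univ _) fun i _ h => by simpa using h
    have h4 : coeff ((s + ∑ i ∈ S, Finsupp.single i 1) + Finsupp.single i 1)
        ((∏ i ∈ S, (X i - C c)) * f) = 0 := by
      refine coeff_eq_zero_of_totalDegree_lt (lt_of_le_of_lt h2 ?_)
      rw [h3]
      simp only [Finsupp.add_apply, Finset.sum_add_distrib, Finsupp.finsetSum_apply]
      rw [Finset.sum_comm]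
      simp [Finsupp.single_apply]
      omega
    rw [h1, mul_comm (X i), coeff_mul_X, ih, h4, mul_zero, sub_zero]

/-- Proportionality follows from the zeros; the constant q^(-|α|) is the coefficient of x^α after
the dilation by q⁻¹. -/
theorem raiseAll_polyG {n : ℕ} (α : Fin n → ℕ) :
    raiseAll qF tF (polyG α) =
      C (qF⁻¹ ^ (∑ i, α i)) * polyG (fun i => α i + 1) := by
  have hα := isInterp_polyG α
  have h1 := (isInterp_polyG fun i => α i + 1).eq_C_mul generic_qF_tF
    (Q := raiseAll qF tF (polyG α)) ?_ ?_
  · rw [h1]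
    congr 2
    have h2 : Finsupp.equivFunOnFinite.symm (fun i => α i + 1) =
        Finsupp.equivFunOnFinite.symm α + ∑ i, Finsupp.single i 1 := by
      ext i
      simp [Finsupp.single_apply]
    rw [h2, raiseAll, coeff_prod_X_sub_C_mul, coeff_dilate, hα.2.2, mul_one]
    · simp
    · exact (totalDegree_dilate_le _ _).trans (by simpa using hα.1)
  · refine (totalDegree_raiseAll_le _ _ _).trans ?_
    simpa [Finset.sum_add_distrib] using hα.1
  · intro β hβ hne
    refine eval_bar_raiseAll_eq_zero generic_qF_tF (fun i => Int.natCast_nonneg _) fun h => ?_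
    have h3 : (fun i => (β i : ℤ) + -1) = fun i => ((β i - 1 : ℕ) : ℤ) := by
      funext i
      have := h i
      omega
    rw [h3]
    have h4 : ∑ i, β i = ∑ i, (β i - 1) + n := by
      have : ∀ i, β i = (β i - 1) + 1 := fun i => by
        have := h i
        omega
      rw [Finset.sum_congr rfl fun i _ => this i]
      simp [Finset.sum_add_distrib]
    refine hα.2.1 _ ?_ fun h5 => hne ?_
    · simp only [Finset.sum_add_distrib] at hβ
      simp at hβ
      omega
    · rw [← h5]
      funext i
      have := h i
      beta_reduce
      omega

theorem ofPoly_injective {n : ℕ} {k : Type*} [Field k] :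
    Function.Injective (ofPoly (n := n) (k := k)) :=
  IsFractionRing.injective (MvPolynomial (Fin n) k) (RatFun n k)

theorem ofPoly_ne_zero {n : ℕ} {k : Type*} [Field k] {f : MvPolynomial (Fin n) k} (hf : f ≠ 0) :
    ofPoly f ≠ 0 := by
  rwa [ne_eq, map_eq_zero_iff _ ofPoly_injective]

/-- The denominator of `G_v`, computed with the shift by `m`, as a polynomial. -/
def denomG {k : Type*} [Field k] (q t : k) (n m : ℕ) : MvPolynomial (Fin n) k :=
  ∏ i, ∏ j ∈ Finset.range m, (X i - C (q ^ (j - m : ℤ) * t ^ (1 - (n : ℤ))))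

theorem denomG_ne_zero {k : Type*} [Field k] (q t : k) (n m : ℕ) : denomG q t n m ≠ 0 :=
  Finset.prod_ne_zero_iff.mpr fun i _ => Finset.prod_ne_zero_iff.mpr fun _ _ =>
    X_sub_C_ne_zero i _

theorem denomG_succ {k : Type*} [Field k] (q t : k) (n m : ℕ) : denomG q t n (m + 1) =
    denomG q t n m * ∏ i, (X i - C (q ^ (-(m + 1) : ℤ) * t ^ (1 - (n : ℤ)))) := by
  rw [denomG, denomG, ← Finset.prod_mul_distrib]
  refine Finset.prod_congr rfl fun i _ => ?_
  rw [Finset.prod_range_succ']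
  congr 1
  · refine Finset.prod_congr rfl fun j _ => ?_
    push_cast
    rw [add_sub_add_right_eq_sub]

theorem shiftG_eq {n : ℕ} (m : ℕ) (v : Fin n → ℤ) : shiftG m v =
    ofPoly (C (qF ^ (-(m : ℤ) * (∑ i, v i) - (m : ℤ) ^ 2 * n)) *
      dilate (qF ^ m) (polyG (shiftComp m v))) / ofPoly (denomG qF tF n m) := by
  rw [shiftG, denomG, map_prod ofPoly]
  congr 1
  refine Finset.prod_congr rfl fun i _ => ?_
  rw [map_prod, qPoch]
  conv_lhs => rw [← Finset.card_range m, ← Finset.prod_const, Finset.card_range]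
  rw [← Finset.prod_mul_distrib]
  refine Finset.prod_congr rfl fun j _ => ?_
  have hX : (ofPoly (X i) : RatFun n BaseF) ≠ 0 := ofPoly_ne_zero (X_ne_zero i)
  have h1 : qF ^ ((j : ℤ) - m) = qF ^ j * qF ^ (-(m : ℤ)) := by
    rw [sub_eq_add_neg, zpow_add₀ qF_ne_zero, zpow_natCast]
  rw [h1]
  simp only [map_sub, map_mul, map_pow]
  field_simp

theorem shiftComp_succ {n : ℕ} {m : ℕ} {v : Fin n → ℤ} (hv : ∀ i, 0 ≤ v i + m) :
    shiftComp (m + 1) v = fun i => shiftComp m v i + 1 := by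
  funext i
  have := hv i
  simp only [shiftComp]
  omega

theorem sum_shiftComp {n : ℕ} {m : ℕ} {v : Fin n → ℤ} (hv : ∀ i, 0 ≤ v i + m) :
    ((∑ i, shiftComp m v i : ℕ) : ℤ) = ∑ i, v i + m * n := by
  push_cast
  rw [Finset.sum_congr rfl fun i _ => show ((shiftComp m v i : ℕ) : ℤ) = v i + m from
    Int.toNat_of_nonneg (hv i)]
  simp [Finset.sum_add_distrib, mul_comm]

/-- This is `raiseAll_polyG` at q^(m+1) x; pulling q^(m+1) out of the n linear factors accounts for
the power of q in `shiftG`. -/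
theorem shiftG_succ {n : ℕ} {m : ℕ} {v : Fin n → ℤ} (hv : ∀ i, 0 ≤ v i + m) :
    shiftG (m + 1) v = shiftG m v := by
  rw [shiftG_eq, shiftG_eq, div_eq_div_iff (ofPoly_ne_zero (denomG_ne_zero _ _ _ _))
    (ofPoly_ne_zero (denomG_ne_zero _ _ _ _)), ← map_mul, ← map_mul, denomG_succ]
  congr 1
  refine funext fun x => ?_
  simp only [map_mul, map_prod, map_sub, eval_C, eval_X, eval_dilate, shiftComp_succ hv]
  have h1 := congrArg (eval fun i => qF ^ (m + 1) * x i) (raiseAll_polyG (shiftComp m v))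
  rw [eval_raiseAll, map_mul, eval_C] at h1
  have hq := qF_ne_zero
  have h2 : (fun i => qF⁻¹ * (qF ^ (m + 1) * x i)) = fun i => qF ^ m * x i := by
    funext i
    field_simp
    ring
  have h3 : ∏ i, (qF ^ (m + 1) * x i - tF ^ (1 - (n : ℤ))) = qF ^ ((m + 1) * (n : ℤ)) *
      ∏ i, (x i - qF ^ (-(m + 1) : ℤ) * tF ^ (1 - (n : ℤ))) := by
    have : qF ^ ((m + 1) * (n : ℤ)) = ∏ _i : Fin n, qF ^ (m + 1) := by
      rw [Finset.prod_const, Finset.card_univ, Fintype.card_fin, zpow_mul, zpow_natCast]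
      norm_cast
    rw [this, ← Finset.prod_mul_distrib]
    refine Finset.prod_congr rfl fun i _ => ?_
    have h4 : qF ^ (-(m + 1) : ℤ) = (qF ^ (m + 1))⁻¹ := by
      rw [zpow_neg]
      norm_cast
    rw [mul_sub, ← mul_assoc, h4, mul_inv_cancel₀ (pow_ne_zero _ hq), one_mul]
  have h4 : qF⁻¹ ^ (∑ i, shiftComp m v i) = qF ^ (-(∑ i, v i + m * n)) := by
    rw [← sum_shiftComp hv, zpow_neg, zpow_natCast, inv_pow]
  rw [h2, h3, h4] at h1
  have h5 : qF ^ (-((m + 1 : ℕ) : ℤ) * (∑ i, v i) - ((m + 1 : ℕ) : ℤ) ^ 2 * n) =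
      qF ^ (-(m : ℤ) * (∑ i, v i) - (m : ℤ) ^ 2 * n) * qF ^ (-((m + 1) * (n : ℤ))) *
        qF ^ (-(∑ i, v i + m * n)) := by
    rw [← zpow_add₀ hq, ← zpow_add₀ hq]
    congr 1
    push_cast
    ring
  have h6 : qF ^ (-((m + 1) * (n : ℤ))) * qF ^ ((m + 1) * (n : ℤ)) = 1 := by
    rw [← zpow_add₀ hq]
    simp
  rw [h5]
  generalize ∏ i, (x i - qF ^ (-(m + 1) : ℤ) * tF ^ (1 - (n : ℤ))) = P at *
  generalize qF ^ (-(m : ℤ) * (∑ i, v i) - (m : ℤ) ^ 2 * n) = A at *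
  generalize qF ^ (-((m + 1) * (n : ℤ))) = B at *
  generalize qF ^ ((m + 1) * (n : ℤ)) = B' at *
  generalize qF ^ (-(∑ i, v i + m * n)) = E at *
  linear_combination -A * B * eval x (denomG qF tF n m) * h1 +
    A * P * eval x (denomG qF tF n m) * eval (fun i => qF ^ m * x i) (polyG (shiftComp m v)) * h6

theorem minShift_nonneg {n : ℕ} (v : Fin n → ℤ) (i : Fin n) : 0 ≤ v i + minShift v := by
  have : (-v i).toNat ≤ minShift v := Finset.le_sup (f := fun i => (-v i).toNat)
    (Finset.mem_univ i)
  omega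

theorem minShift_le {n : ℕ} {v : Fin n → ℤ} {m : ℕ} (hv : ∀ i, 0 ≤ v i + m) : minShift v ≤ m :=
  Finset.sup_le fun i _ => by
    have := hv i
    omega

theorem shift_independent {n : ℕ} {α : Type*} {f : ℕ → α} {v : Fin n → ℤ}
    (hf : ∀ m : ℕ, (∀ i, 0 ≤ v i + m) → f (m + 1) = f m) {m : ℕ} (hv : ∀ i, 0 ≤ v i + m) :
    f m = f (minShift v) := by
  induction m, minShift_le hv using Nat.le_induction with
  | base => rfl
  | succ m hm ih =>
    have hv' : ∀ i, 0 ≤ v i + m := fun i => by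
      have := minShift_nonneg v i
      omega
    rw [hf m hv', ih hv']

end ShiftG

/-! ### Passage to 𝕂 and comparison of K_v with G_v -/

section ShiftK

theorem eval_map_apply {k l : Type*} [Field k] [Field l] (φ : k →+* l) {n : ℕ}
    (f : MvPolynomial (Fin n) k) (x : Fin n → k) :
    eval (fun i => φ (x i)) (map φ f) = φ (eval x f) := by
  rw [eval_map]
  exact (eval₂_comp φ x f).symm

theorem bar_qK_tK {n : ℕ} (v : Fin n → ℤ) :
    bar qK tK v = fun i => inclFK (bar qF tF v i) := by
  funext i
  simp [bar, qK, tK]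

instance : CharZero BaseK := charZero_of_injective_ringHom inclFK.injective

theorem aK_ne_inclFK (c : BaseF) : aK ≠ inclFK c := by
  intro h
  rw [aK, inclFK, ← RatFunc.algebraMap_X, ← RatFunc.algebraMap_C] at h
  exact Polynomial.X_ne_C c (RatFunc.algebraMap_injective BaseF h)

theorem genericTriple : GenericTriple qK tK aK where
  q_ne := (map_ne_zero inclFK).mpr qF_ne_zero
  t_ne := (map_ne_zero inclFK).mpr tF_ne_zero
  pow_ne m b hm h := by
    rw [qK, tK, ← map_zpow₀, ← map_zpow₀] at h
    exact generic_qF_tF.pow_ne m b hm (inclFK.injective h)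
  t_ne_one h := by
    rw [tK, ← map_one inclFK] at h
    have h1 := qF_zpow_mul_tF_zpow_eq_one (a := 0) (b := 1) (by simp [inclFK.injective h])
    omega
  a_ne h := aK_ne_inclFK 0 (by rw [h, map_zero])
  a_mul_ne m b h := by
    rw [qK, tK, ← map_zpow₀, ← map_zpow₀, ← map_mul] at h
    apply aK_ne_inclFK (qF ^ m * tF ^ b)⁻¹
    rw [map_inv₀]
    exact eq_inv_of_mul_eq_one_left h

/-- The interpolation polynomials over `𝕂`, indexed by integral vectors. -/
def famK (n : ℕ) (v : Fin n → ℤ) : MvPolynomial (Fin n) BaseK :=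
  map inclFK (polyG fun i => (v i).toNat)

theorem isFamily_famK (n : ℕ) : IsFamily qK tK (famK n) where
  degree_le v hv := by
    lift v to Fin n → ℕ using hv
    have h1 : (map inclFK (polyG v)).totalDegree ≤ (polyG v).totalDegree :=
      Finset.sup_mono (support_map_subset _ _)
    simpa [famK] using Int.ofNat_le.mpr (h1.trans (isInterp_polyG v).1)
  vanish v w hv hw hd hne := by
    lift v to Fin n → ℕ using hv
    lift w to Fin n → ℕ using hw
    rw [famK, bar_qK_tK, eval_map_apply]
    have h1 : w ≠ v := fun h => hne (by rw [h])
    have h2 : ∑ i, w i ≤ ∑ i, v i := by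
      beta_reduce at hd
      exact_mod_cast hd
    simp only [Int.toNat_natCast]
    rw [(isInterp_polyG v).2.1 w h2 h1, map_zero]
  ne_zero v hv h := by
    rw [famK, map_eq_zero_iff _ (map_injective _ inclFK.injective)] at h
    have := (isInterp_polyG fun i => (v i).toNat).2.2
    rw [h, coeff_zero] at this
    exact zero_ne_one this

theorem eval_polyK {n : ℕ} (m : ℕ) (v : Fin n → ℤ) (x : Fin n → BaseK) :
    eval x (polyK (shiftComp m v)) = normEval tK aK (famK n) (fun i => v i + m) x := by
  rw [polyK, map_mul, eval_C, normEval, div_eq_inv_mul]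
  rfl

/-- The denominator of `K_v`, computed with the shift by `m`, as a polynomial. -/
def denomK {k : Type*} [Field k] (q t : k) (n m : ℕ) : MvPolynomial (Fin n) k :=
  ∏ i, ∏ j ∈ Finset.range m, (1 - C (q ^ j * (q * t ^ ((n : ℤ) - 1))) * X i)

/-- The numerator of `K_v`, computed with the shift by `m`, as a polynomial. -/
def numerK {n : ℕ} (m : ℕ) (v : Fin n → ℤ) : MvPolynomial (Fin n) BaseK :=
  C (∏ i, qPoch qK (qK ^ (1 - (m : ℤ)) * aK * (bar qK tK v i)⁻¹) m) *
    dilate (qK ^ m) (polyK (shiftComp m v))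

theorem shiftK_eq {n : ℕ} (m : ℕ) (v : Fin n → ℤ) :
    shiftK m v = ofPoly (numerK m v) / ofPoly (denomK qK tK n m) := by
  rw [shiftK, ratA, Finset.prod_div_distrib, numerK, denomK, div_mul_eq_mul_div, map_mul ofPoly (C _),
    map_prod C, map_prod ofPoly, map_prod ofPoly]
  congr 1
  refine Finset.prod_congr rfl fun i _ => ?_
  rw [qPoch, map_prod ofPoly]
  refine Finset.prod_congr rfl fun j _ => ?_
  simp only [map_sub, map_mul, map_pow, map_one]
  ring

theorem eval_denomK {k : Type*} [Field k] (q t : k) (n m : ℕ) (x : Fin n → k) :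
    eval x (denomK q t n m) = ∏ i, qPoch q (q * (t ^ ((n : ℤ) - 1) * x i)) m := by
  rw [denomK, map_prod]
  refine Finset.prod_congr rfl fun i _ => ?_
  rw [map_prod, qPoch]
  refine Finset.prod_congr rfl fun j _ => ?_
  simp only [map_sub, map_mul, map_one, eval_C, eval_X]
  ring

theorem eval_numerK {n : ℕ} (m : ℕ) (v : Fin n → ℤ) (x : Fin n → BaseK) :
    eval x (numerK m v) =
      (∏ i, qPoch qK (qK ^ (1 - (m : ℤ)) * aK * (bar qK tK v i)⁻¹) m) *
        normEval tK aK (famK n) (fun i => v i + m) (fun i => qK ^ m * x i) := by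
  rw [numerK, map_mul, eval_C, eval_dilate, eval_polyK]

theorem eval_denomK_tilde {n : ℕ} (m : ℕ) (u : Fin n → ℤ) :
    eval (fun i => aK * tilde qK tK u i) (denomK qK tK n m) =
      ∏ i, qPoch qK (qK ^ (1 : ℤ) * aK * (bar qK tK u i)⁻¹) m := by
  rw [eval_denomK, prod_qPoch_tilde genericTriple]

/-- At aũ the denominator becomes a product of Pochhammer symbols in a ū_i⁻¹, nonzero because a is
not a monomial in q and t. -/
theorem hasValueAt_shiftK {n : ℕ} (m : ℕ) (v u : Fin n → ℤ) :
    HasValueAt (shiftK m v) (fun i => aK * tilde qK tK u i)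
      (extEval qK tK aK (famK n) m v u) := by
  refine ⟨numerK m v, denomK qK tK n m, ?_, shiftK_eq m v, ?_⟩
  · rw [eval_denomK_tilde]
    exact prod_qPoch_ne_zero genericTriple u 1 m
  · rw [eval_denomK_tilde, eval_numerK, extEval, div_mul_eq_mul_div]
    congr 3
    funext i
    rw [zpow_natCast, mul_assoc]

/-- The constant `d_K / d_G` relating the denominators of `K_v` and `G_v`. -/
theorem denomK_eq {k : Type*} [Field k] {q t : k} (hq : q ≠ 0) (ht : t ≠ 0) (n m : ℕ) :
    denomK q t n m = C (∏ _i : Fin n, ∏ j ∈ Finset.range m, (-(q ^ j * (q * t ^ ((n : ℤ) - 1))))) *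
      denomG q t n m := by
  rw [denomK, denomG, map_prod C, ← Finset.prod_mul_distrib]
  refine Finset.prod_congr rfl fun i _ => ?_
  -- The root q^(-(j+1)) t^(1-n) of factor j on the left belongs to factor m - 1 - j of `denomG`.
  rw [map_prod C, ← Finset.prod_range_reflect (fun j => X i - C (q ^ (j - m : ℤ) * _)),
    ← Finset.prod_mul_distrib]
  refine Finset.prod_congr rfl fun j hj => ?_
  have hj' := Finset.mem_range.mp hj
  have h1 : q ^ (((m - 1 - j : ℕ) : ℤ) - m) = (q ^ j * q)⁻¹ := by
    rw [← pow_succ, ← zpow_natCast, ← zpow_neg]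
    congr 1
    omega
  have h2 : t ^ (1 - (n : ℤ)) = (t ^ ((n : ℤ) - 1))⁻¹ := by
    rw [← zpow_neg, neg_sub]
  have h3 : (q ^ j * (q * t ^ ((n : ℤ) - 1))) * (q ^ (((m - 1 - j : ℕ) : ℤ) - m) *
      t ^ (1 - (n : ℤ))) = 1 := by
    rw [h1, h2]
    have := zpow_ne_zero ((n : ℤ) - 1) ht
    field_simp
  have h4 := congrArg (C (σ := Fin n)) h3
  rw [C_mul, C_1] at h4
  rw [C_neg]
  linear_combination -h4

theorem denomK_ne_zero {k : Type*} [Field k] {q t : k} (hq : q ≠ 0) (ht : t ≠ 0) (n m : ℕ) :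
    denomK q t n m ≠ 0 := by
  rw [denomK_eq hq ht]
  refine mul_ne_zero ?_ (denomG_ne_zero _ _ _ _)
  rw [ne_eq, C_eq_zero]
  exact Finset.prod_ne_zero_iff.mpr fun i _ => Finset.prod_ne_zero_iff.mpr fun j _ =>
    neg_ne_zero.mpr (mul_ne_zero (pow_ne_zero _ hq) (mul_ne_zero hq (zpow_ne_zero _ ht)))

theorem numerK_succ_mul {n : ℕ} {m : ℕ} {v : Fin n → ℤ} (hv : ∀ i, 0 ≤ v i + m) :
    numerK (m + 1) v * denomK qK tK n m = numerK m v * denomK qK tK n (m + 1) := by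
  refine funext fun x => ?_
  rw [map_mul, map_mul, eval_denomK, eval_denomK, eval_numerK, eval_numerK]
  exact normEval_shift_succ genericTriple (isFamily_famK n) (v := v) hv x

theorem shiftK_succ {n : ℕ} {m : ℕ} {v : Fin n → ℤ} (hv : ∀ i, 0 ≤ v i + m) :
    shiftK (m + 1) v = shiftK m v := by
  have hd := fun m => ofPoly_ne_zero
    (denomK_ne_zero genericTriple.q_ne genericTriple.t_ne n m)
  rw [shiftK_eq, shiftK_eq, div_eq_div_iff (hd _) (hd _), ← map_mul, ← map_mul,
    numerK_succ_mul hv]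

theorem inclRat_ofPoly {n : ℕ} (f : MvPolynomial (Fin n) BaseF) :
    inclRat n (ofPoly f) = ofPoly (map inclFK f) :=
  IsFractionRing.lift_algebraMap _ f

theorem map_dilate {k l : Type*} [Field k] [Field l] (φ : k →+* l) {n : ℕ} (c : k)
    (f : MvPolynomial (Fin n) k) : map φ (dilate c f) = dilate (φ c) (map φ f) := by
  rw [dilate, dilate, map_bind₁]
  simp

theorem map_denomG {k l : Type*} [Field k] [Field l] (φ : k →+* l) (q t : k) (n m : ℕ) :
    map φ (denomG q t n m) = denomG (φ q) (φ t) n m := by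
  simp [denomG, map_prod]

theorem HasValueAt.C_mul {n : ℕ} {k : Type*} [Field k] {f : RatFun n k} {y : Fin n → k} {c : k}
    (h : HasValueAt f y c) (r : k) : HasValueAt (ofPoly (C r) * f) y (r * c) := by
  obtain ⟨p, d, hd, hf, rfl⟩ := h
  refine ⟨C r * p, d, hd, ?_, ?_⟩
  · rw [hf, map_mul, mul_div_assoc]
  · rw [map_mul, eval_C, mul_div_assoc]

/-- Both functions are multiples of one dilated polynomial over proportional denominators. The
constant need not be known: K_v(aτ) = 1 later identifies it as G_v(aτ). -/
theorem exists_inclRat_ratG_eq {n : ℕ} (v : Fin n → ℤ) :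
    ∃ c, c ≠ 0 ∧ inclRat n (ratG v) = ofPoly (C c) * ratK v := by
  have h := genericTriple
  set m := minShift v
  have hv : 0 ≤ fun i => v i + (m : ℤ) := minShift_nonneg v
  set y := eval (fun i => aK * tau tK n i) (map inclFK (polyG (shiftComp m v))) with hy
  have hy0 : y ≠ 0 := (isFamily_famK n).eval_tau_ne_zero h hv
  set N := ∏ i, qPoch qK (qK ^ (1 - (m : ℤ)) * aK * (bar qK tK v i)⁻¹) m with hN
  have hN0 : N ≠ 0 := prod_qPoch_ne_zero h v _ m
  set e := qK ^ (-(m : ℤ) * (∑ i, v i) - (m : ℤ) ^ 2 * n) with he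
  have he0 : e ≠ 0 := zpow_ne_zero _ h.q_ne
  set M := ∏ _i : Fin n, ∏ j ∈ Finset.range m, (-(qK ^ j * (qK * tK ^ ((n : ℤ) - 1)))) with hM
  have hd := denomK_eq h.q_ne h.t_ne n m
  rw [← hM] at hd
  have hd0 := denomK_ne_zero h.q_ne h.t_ne n m
  have hM0 : M ≠ 0 := by
    intro h0
    rw [hd, h0, C_0, zero_mul] at hd0
    exact hd0 rfl
  refine ⟨e * M * y * N⁻¹, mul_ne_zero (mul_ne_zero (mul_ne_zero he0 hM0) hy0) (inv_ne_zero hN0),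
    ?_⟩
  have h1 : numerK m v = C (N * y⁻¹) * dilate (qK ^ m) (map inclFK (polyG (shiftComp m v))) := by
    rw [numerK, polyK, ← hy, ← hN, dilate, map_mul, bind₁_C_right, C_mul, mul_assoc]
    rfl
  rw [ratG, ratK, shiftG_eq, shiftK_eq, map_div₀, inclRat_ofPoly, inclRat_ofPoly, map_denomG,
    ← mul_div_assoc, div_eq_div_iff (ofPoly_ne_zero (denomG_ne_zero _ _ _ _)) (ofPoly_ne_zero hd0),
    ← map_mul, ← map_mul, ← map_mul]
  congr 1
  change map inclFK (C (qF ^ (-(m : ℤ) * (∑ i, v i) - (m : ℤ) ^ 2 * n)) *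
    dilate (qF ^ m) (polyG (shiftComp m v))) * denomK qK tK n m =
      C (e * M * y * N⁻¹) * numerK m v * denomG qK tK n m
  have h2 : inclFK (qF ^ (-(m : ℤ) * (∑ i, v i) - (m : ℤ) ^ 2 * n)) = e := by
    rw [map_zpow₀]
    rfl
  have h3 : inclFK (qF ^ m) = qK ^ m := map_pow _ _ _
  rw [map_mul, map_C, map_dilate, h1, hd, h2, h3]
  have h4 : e * M * y * N⁻¹ * (N * y⁻¹) = e * M := by
    field_simp
  have h5 := congrArg (C (σ := Fin n)) h4
  rw [C_mul, C_mul (a := e)] at h5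
  linear_combination -(dilate (qK ^ m) (map inclFK (polyG (shiftComp m v))) *
    denomG qK tK n m) * h5

end ShiftK

/-- The value of `K_v` at `a ũ`. -/
def valueK {n : ℕ} (v u : Fin n → ℤ) : BaseK :=
  extEval qK tK aK (famK n) (minShift v) v u

theorem valueK_eq {n : ℕ} {m : ℕ} {v : Fin n → ℤ} (hv : ∀ i, 0 ≤ v i + m) (u : Fin n → ℤ) :
    valueK v u = extEval qK tK aK (famK n) m v u :=
  (shift_independent (f := fun m => extEval qK tK aK (famK n) m v u)
    (fun _ hm => extEval_succ genericTriple (isFamily_famK n) hm u) hv).symm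

theorem valueK_rot {n l : ℕ} (hl : n = l + 1) (v u : Fin (l + 1) → ℤ) :
    (aK * (bar qK tK v 0)⁻¹ - 1) * valueK (rot v ∘ Fin.cast hl) (u ∘ Fin.cast hl) =
      (aK * (bar qK tK u 0)⁻¹ - 1) * valueK (v ∘ Fin.cast hl) (rot u ∘ Fin.cast hl) := by
  subst hl
  simp only [Fin.cast_refl, Function.comp_id]
  have hv := minShift_nonneg v
  have hr : ∀ i, 0 ≤ rot v i + minShift v := by
    intro i
    refine Fin.lastCases ?_ (fun i => ?_) i
    · have := hv 0
      rw [rot_last]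
      omega
    · simpa using hv i.succ
  rw [valueK_eq hr, valueK_eq hv]
  exact extEval_rot genericTriple (isFamily_famK _) hv u

theorem valueK_symm {n : ℕ} (v u : Fin n → ℤ) : valueK v u = valueK u v := by
  have h := genericTriple
  have hg := isFamily_famK n
  refine symm_of_recurrences h (F := valueK) (fun u => ?_) (fun v => ?_) ?_ ?_ (fun v u => ?_) v u
  · rw [valueK_eq (m := 0) (by simp), extEval_zero_left hg]
  · exact extEval_zero_right h hg (minShift_nonneg v)
  · intro v u i j i' j' hij hi' hj'
    have hv := minShift_nonneg v
    rw [valueK_eq hv, valueK_eq hv,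
      valueK_eq (m := minShift v) (v := v ∘ Equiv.swap i j) fun l => hv (Equiv.swap i j l)]
    exact extEval_hecke h hg hv hij hi' hj' u
  · exact fun l hl => valueK_rot hl
  · have hv := minShift_nonneg v
    -- The shifts m + 1 for v and m for v + 1 lead to the same composition, as `extEval_succ_eq`
    -- requires.
    rw [valueK_eq (m := minShift v + 1) (fun i => by have := hv i; omega),
      valueK_eq (m := minShift v) (v := fun i => v i + 1) (fun i => by have := hv i; omega)]
    exact extEval_succ_eq h _ v u

end InterpMac

end

theorem theoremB (n : ℕ) :
    -- for compositions, the defining conditions determine exactly one polynomial, `G_α`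
    (∀ (α : Fin n → ℕ) (P : MvPolynomial (Fin n) InterpMac.BaseF),
      InterpMac.IsInterp InterpMac.qF InterpMac.tF α P ↔ P = InterpMac.polyG α) ∧
    -- `G_v` and `K_v` do not depend on the choice of `m` with `v + (m ^ n)` a composition
    (∀ (v : Fin n → ℤ) (m : ℕ), (∀ i, 0 ≤ v i + m) →
      InterpMac.shiftG m v = InterpMac.ratG v ∧ InterpMac.shiftK m v = InterpMac.ratK v) ∧
    -- `K_v = G_v / G_v(a τ)`, where `G_v(a τ)` is defined and not zero
    (∀ v : Fin n → ℤ, ∃ c : InterpMac.BaseK, c ≠ 0 ∧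
      InterpMac.HasValueAt (InterpMac.inclRat n (InterpMac.ratG v))
        (fun i => InterpMac.aK * InterpMac.tau InterpMac.tK n i) c ∧
      InterpMac.ratK v =
        InterpMac.inclRat n (InterpMac.ratG v) / InterpMac.ofPoly (MvPolynomial.C c)) ∧
    -- duality `K_u(a ṽ) = K_v(a ũ)`, where both sides are defined
    (∀ u v : Fin n → ℤ, ∃ c : InterpMac.BaseK,
      InterpMac.HasValueAt (InterpMac.ratK u)
        (fun i => InterpMac.aK * InterpMac.tilde InterpMac.qK InterpMac.tK v i) c ∧
      InterpMac.HasValueAt (InterpMac.ratK v)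
        (fun i => InterpMac.aK * InterpMac.tilde InterpMac.qK InterpMac.tK u i) c) := by
  refine ⟨InterpMac.isInterp_iff, fun v m hv => ⟨?_, ?_⟩, fun v => ?_, fun u v => ?_⟩
  · exact InterpMac.shift_independent (f := fun m => InterpMac.shiftG m v)
      (fun _ hm => InterpMac.shiftG_succ hm) hv
  · exact InterpMac.shift_independent (f := fun m => InterpMac.shiftK m v)
      (fun _ hm => InterpMac.shiftK_succ hm) hv
  · obtain ⟨c, hc, h⟩ := InterpMac.exists_inclRat_ratG_eq v
    refine ⟨c, hc, ?_, ?_⟩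
    -- Taking u = 0 turns the point aũ into aτ, where K_v has value 1.
    · have h1 := InterpMac.hasValueAt_shiftK (InterpMac.minShift v) v 0
      rw [InterpMac.tilde_zero, InterpMac.extEval_zero_right InterpMac.genericTriple
        (InterpMac.isFamily_famK n) (InterpMac.minShift_nonneg v)] at h1
      have h2 := h1.C_mul c
      rw [mul_one] at h2
      rw [h]
      exact h2
    · rw [h, mul_div_cancel_left₀]
      refine InterpMac.ofPoly_ne_zero ?_
      rwa [ne_eq, MvPolynomial.C_eq_zero]
  · refine ⟨InterpMac.valueK u v, InterpMac.hasValueAt_shiftK _ u v, ?_⟩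
    rw [InterpMac.valueK_symm]
    exact InterpMac.hasValueAt_shiftK _ v u
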